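/- Let $(x_n)_{n\ge 1}$ be a sequence of pairwise distinct points that is dense in $[0,1]$, and let $(k_n)_{n\ge 2}$ be a sequence of non-negative integers with $$\prod_{n=2}^{\infty}\frac{10^{k_n}-1}{10^{k_n}}>\frac{11}{12}.$$ Put $A_1=M_{10}(C[0,1])$ and $A_{n+1}=M_{10^{k_{n+1}}}(A_n)$ for $n\ge 1$, so that $A_n=M_{L_n}(C[0,1])=C([0,1],M_{L_n}(\mathbb C))$ with $L_n=10\prod_{i=2}^n10^{k_i}$, and let $\varphi_{n,n+1}:A_n\to A_{n+1}$ be the unital $*$-homomorphism $$\varphi_{n,n+1}(f)=\operatorname{diag}\bigl(f,\dots,f,f(x_n)\bigr)$$ with $10^{k_{n+1}}$ diagonal blocks, the last of which is the constant function with value $f(x_n)$. Let $A=\varinjlim(A_n,\varphi_{n,n+1})$ be the inductive limit $C^*$-algebra, with canonical map $\varphi_{1,\infty}:A_1\to A$, and let $u\in A_1$ be the unitary $$u(t)=\operatorname{diag}\bigl(e^{-2\pi i t\cdot 9/10},\,e^{2\pi i t/10},\dots,e^{2\pi i t/10}\bigr)\in M_{10}(\mathbb C),\qquad t\in[0,1].$$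 Then: 1. $A$ is simple, i.e. $A\ne 0$ and $A$ has no closed two-sided ideals other than $0$ and $A$; and $A$ is a (unital) AH algebra, i.e. it is isomorphic to the inductive limit of a sequence of finite direct sums of algebras $pM_d(C(X))p$ with $X$ compact metrizable and $p\in M_d(C(X))$ a projection. 2. $\varphi_{1,\infty}(u)\in CU(A)$, the closure of the commutator subgroup of the unitary group $U(A)$. 3. $\varphi_{1,\infty}(u)$ lies in the connected component of $1$ in $U(A)$, and $$cel(\varphi_{1,\infty}(u))\ge 2\pi\cdot\frac{9}{10},$$ where $cel(v)=\inf\bigl\{\sum_{j=1}^m\|h_j\| : v=e^{ih_1}\cdots e^{ih_m},\ h_j=h_j^*\in A\bigr\}$ is the $C^*$ exponential length. -/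

import Mathlib

open scoped Matrix.Norms.L2Operator

noncomputable section

/-! ### Sequential inductive limits of unital C*-algebras -/

namespace CStarIndLim

open Filter Topology UniformSpace

variable {B : ℕ → Type*} [∀ n, CStarAlgebra (B n)] (φ : ∀ n, B n →⋆ₐ[ℂ] B (n + 1))

/-- The composite connecting map `φ_{i,n} : B i → B n` for `i ≤ n`. -/
def trans (i : ℕ) {n : ℕ} (h : i ≤ n) : B i →⋆ₐ[ℂ] B n :=
  Nat.leRec (motive := fun n _ => B i →⋆ₐ[ℂ] B n) (StarAlgHom.id ℂ (B i))
    (fun n _ f => (φ n).comp f) h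

theorem trans_succ (i : ℕ) {n : ℕ} (h : i ≤ n) (a : B i) :
    trans φ i (h.trans n.le_succ) a = φ n (trans φ i h a) := by
  have := Nat.leRec_succ (motive := fun n _ => B i →⋆ₐ[ℂ] B n) (StarAlgHom.id ℂ (B i))
    (fun n _ f => (φ n).comp f) h (h2 := h.trans n.le_succ)
  exact congrArg (fun f : B i →⋆ₐ[ℂ] B (n + 1) => f a) this

/-- The sequences `(a n)` with `a (n + 1) = φ n (a n)` for all sufficiently large `n`. -/
def eventuallyCoherent : StarSubalgebra ℂ (∀ n, B n) where
  carrier := {a | ∀ᶠ n in atTop, a (n + 1) = φ n (a n)}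
  mul_mem' {a b} ha hb := by
    filter_upwards [ha, hb] with n h1 h2
    simp [h1, h2]
  add_mem' {a b} ha hb := by
    filter_upwards [ha, hb] with n h1 h2
    simp [h1, h2]
  algebraMap_mem' c := Eventually.of_forall fun n => by
    simp [Pi.algebraMap_apply, AlgHomClass.commutes]
  star_mem' {a} ha := by
    filter_upwards [ha] with n h1
    simp [h1, map_star]

/-- The type of eventually coherent sequences, to be seminormed by `‖a‖ = lim ‖a n‖`. Its
quotient by the null sequences is the algebraic inductive limit modulo the elements of norm `0`. -/
def PreLim : Type _ := eventuallyCoherent φ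

instance : Ring (PreLim φ) := inferInstanceAs (Ring (eventuallyCoherent φ))
instance : Algebra ℂ (PreLim φ) := inferInstanceAs (Algebra ℂ (eventuallyCoherent φ))
instance : StarRing (PreLim φ) := inferInstanceAs (StarRing (eventuallyCoherent φ))
instance : StarModule ℂ (PreLim φ) := inferInstanceAs (StarModule ℂ (eventuallyCoherent φ))

variable {φ}

/-- The limit of the norms of the terms (see `tendsto_lnorm`). -/
def lnorm (a : PreLim φ) : ℝ := limUnder atTop fun n => ‖a.1 n‖

theorem tendsto_lnorm (a : PreLim φ) : Tendsto (fun n => ‖a.1 n‖) atTop (𝓝 (lnorm a)) := by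
  refine tendsto_nhds_limUnder ?_
  obtain ⟨N, hN⟩ := eventually_atTop.1 a.2
  have hanti : Antitone fun n => ‖a.1 (n + N)‖ := antitone_nat_of_succ_le fun n => by
    have h := hN (n + N) (by omega)
    have e : n + 1 + N = n + N + 1 := by omega
    rw [e, h]
    exact NonUnitalStarAlgHom.norm_apply_le (φ (n + N)) _
  have hb : BddBelow (Set.range fun n => ‖a.1 (n + N)‖) :=
    ⟨0, by rintro _ ⟨n, rfl⟩; exact norm_nonneg _⟩
  exact ⟨_, (tendsto_add_atTop_iff_nat N).1 (tendsto_atTop_ciInf hanti hb)⟩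

theorem lnorm_eq {a : PreLim φ} {r : ℝ} (h : Tendsto (fun n => ‖a.1 n‖) atTop (𝓝 r)) :
    lnorm a = r :=
  tendsto_nhds_unique (tendsto_lnorm a) h

variable (φ) in
/-- The seminorm `a ↦ lim ‖a n‖`. -/
def lnormSeminorm : RingSeminorm (PreLim φ) where
  toFun := lnorm
  map_zero' := lnorm_eq (by
    have : (fun n => ‖(0 : PreLim φ).1 n‖) = fun _ => (0 : ℝ) := funext fun n => norm_zero
    rw [this]; exact tendsto_const_nhds)
  add_le' a b := le_of_tendsto_of_tendsto' (tendsto_lnorm (a + b))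
    ((tendsto_lnorm a).add (tendsto_lnorm b)) fun n => norm_add_le (a.1 n) (b.1 n)
  neg' a := lnorm_eq (by
    have : (fun n => ‖(-a : PreLim φ).1 n‖) = fun n => ‖a.1 n‖ := funext fun n => norm_neg (a.1 n)
    rw [this]; exact tendsto_lnorm a)
  mul_le' a b := le_of_tendsto_of_tendsto' (tendsto_lnorm (a * b))
    ((tendsto_lnorm a).mul (tendsto_lnorm b)) fun n => norm_mul_le (a.1 n) (b.1 n)

instance : SeminormedRing (PreLim φ) := (lnormSeminorm φ).toSeminormedRing

theorem norm_def (a : PreLim φ) : ‖a‖ = lnorm a := rfl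

instance : NormedAlgebra ℂ (PreLim φ) where
  norm_smul_le c a := le_of_tendsto_of_tendsto' (tendsto_lnorm (c • a))
    (tendsto_const_nhds.mul (tendsto_lnorm a)) fun n => norm_smul_le c (a.1 n)

theorem norm_star' (a : PreLim φ) : ‖star a‖ = ‖a‖ := lnorm_eq (by
  have : (fun n => ‖(star a : PreLim φ).1 n‖) = fun n => ‖a.1 n‖ := funext fun n => norm_star (a.1 n)
  rw [this]; exact tendsto_lnorm a)

theorem norm_star_mul' (a : PreLim φ) : ‖star a * a‖ = ‖a‖ * ‖a‖ := lnorm_eq (by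
  have : (fun n => ‖(star a * a : PreLim φ).1 n‖) = fun n => ‖a.1 n‖ * ‖a.1 n‖ :=
    funext fun n => CStarRing.norm_star_mul_self (x := a.1 n)
  rw [this]; exact (tendsto_lnorm a).mul (tendsto_lnorm a))

theorem uniformContinuous_star' : UniformContinuous (star : PreLim φ → PreLim φ) :=
  (Isometry.of_dist_eq fun a b => by
    rw [dist_eq_norm, dist_eq_norm, ← star_sub, norm_star']).uniformContinuous

variable (φ) in
/-- The C*-algebraic inductive limit `lim (B n, φ n)`: the (Hausdorff) completion of the
eventually coherent sequences in the seminorm `‖a‖ = lim ‖a n‖`. -/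
def Lim : Type _ := Completion (PreLim φ)

instance : NormedRing (Lim φ) := inferInstanceAs (NormedRing (Completion (PreLim φ)))
instance : CompleteSpace (Lim φ) := inferInstanceAs (CompleteSpace (Completion (PreLim φ)))
instance : Algebra ℂ (Lim φ) := inferInstanceAs (Algebra ℂ (Completion (PreLim φ)))
instance : NormedAlgebra ℂ (Lim φ) where
  norm_smul_le := norm_smul_le (α := ℂ) (β := Completion (PreLim φ))

/-- The class of an eventually coherent sequence in the limit. -/
def mk (a : PreLim φ) : Lim φ := (a : Completion (PreLim φ))

theorem mk_add (a b : PreLim φ) : mk (a + b) = mk a + mk b := Completion.coe_add a b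
theorem mk_mul (a b : PreLim φ) : mk (a * b) = mk a * mk b := Completion.coe_mul a b
theorem mk_smul (c : ℂ) (a : PreLim φ) : mk (c • a) = c • mk a := Completion.coe_smul c a
theorem norm_mk (a : PreLim φ) : ‖mk a‖ = ‖a‖ := Completion.norm_coe a
theorem mk_sub (a b : PreLim φ) : mk (a - b) = mk a - mk b := Completion.coe_sub a b
theorem continuous_mk : Continuous (mk : PreLim φ → Lim φ) := Completion.continuous_coe _

theorem denseRange_mk : DenseRange (mk : PreLim φ → Lim φ) := Completion.denseRange_coe

theorem induction {p : Lim φ → Prop} (hp : IsClosed {a | p a}) (h : ∀ a, p (mk a)) (a : Lim φ) :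
    p a :=
  denseRange_mk.induction_on a hp h

theorem induction₂ {p : Lim φ → Lim φ → Prop}
    (hp : IsClosed {q : Lim φ × Lim φ | p q.1 q.2}) (h : ∀ a b, p (mk a) (mk b)) (a b : Lim φ) :
    p a b :=
  denseRange_mk.induction_on₂ hp h a b

/-- Two eventually equal sequences have the same class. -/
theorem mk_eq_mk {a b : PreLim φ} (h : ∀ᶠ n in atTop, a.1 n = b.1 n) : mk a = mk b := by
  rw [← sub_eq_zero, ← mk_sub, ← norm_eq_zero, norm_mk]
  refine lnorm_eq (tendsto_const_nhds.congr' ?_)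
  filter_upwards [h] with n hn
  have : (a - b : PreLim φ).1 n = a.1 n - b.1 n := rfl
  rw [this, hn, sub_self, norm_zero]

instance : Star (Lim φ) := ⟨Completion.map (star : PreLim φ → PreLim φ)⟩

theorem mk_star (a : PreLim φ) : mk (star a) = star (mk a) :=
  (Completion.map_coe uniformContinuous_star' a).symm

theorem continuous_star' : Continuous (star : Lim φ → Lim φ) := Completion.continuous_map

instance : StarRing (Lim φ) where
  star_involutive a := induction (p := fun a => star (star a) = a)
    (isClosed_eq (continuous_star'.comp continuous_star') continuous_id)
    (fun a => by rw [← mk_star, ← mk_star, star_star]) a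
  star_mul a b := induction₂ (p := fun a b => star (a * b) = star b * star a)
    (isClosed_eq (continuous_star'.comp (continuous_fst.mul continuous_snd))
      ((continuous_star'.comp continuous_snd).mul (continuous_star'.comp continuous_fst)))
    (fun a b => by simp only [← mk_star, ← mk_mul, star_mul]) a b
  star_add a b := induction₂ (p := fun a b => star (a + b) = star a + star b)
    (isClosed_eq (continuous_star'.comp (continuous_fst.add continuous_snd))
      ((continuous_star'.comp continuous_fst).add (continuous_star'.comp continuous_snd)))
    (fun a b => by simp only [← mk_star, ← mk_add, star_add]) a b

instance : CStarAlgebra (Lim φ) where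
  star_smul c a := induction (p := fun a => star (c • a) = star c • star a)
    (isClosed_eq (continuous_star'.comp (continuous_const_smul c))
      (continuous_star'.const_smul (star c)))
    (fun a => by simp only [← mk_star, ← mk_smul, star_smul]) a
  norm_mul_self_le a := induction (p := fun a => ‖a‖ * ‖a‖ ≤ ‖star a * a‖)
    (isClosed_le (continuous_norm.mul continuous_norm)
      (continuous_norm.comp (continuous_star'.mul continuous_id)))
    (fun a => by rw [← mk_star, ← mk_mul, norm_mk, norm_mk, norm_star_mul']) a

variable (φ)

/-- The sequence `n ↦ φ_{i,n} a`, padded with `0` at the indices `n < i`. -/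
def toSeq (i : ℕ) (a : B i) : PreLim φ :=
  ⟨fun n => if h : i ≤ n then trans φ i h a else 0, by
    filter_upwards [eventually_ge_atTop i] with n hn
    rw [dif_pos hn, dif_pos (hn.trans n.le_succ), trans_succ]⟩

theorem toSeq_apply {i n : ℕ} (h : i ≤ n) (a : B i) : (toSeq φ i a).1 n = trans φ i h a := dif_pos h

/-- The canonical map `φ_{i,∞} : B i → lim (B n, φ n)`. -/
def toLim (i : ℕ) : B i →⋆ₐ[ℂ] Lim φ where
  toFun a := mk (toSeq φ i a)
  map_one' := mk_eq_mk (b := 1) (by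
    filter_upwards [eventually_ge_atTop i] with n hn
    rw [toSeq_apply φ hn, map_one]; rfl)
  map_mul' a b := by
    rw [← mk_mul]
    refine mk_eq_mk ?_
    filter_upwards [eventually_ge_atTop i] with n hn
    rw [toSeq_apply φ hn, map_mul, ← toSeq_apply φ hn, ← toSeq_apply φ hn]; rfl
  map_zero' := mk_eq_mk (b := 0) (by
    filter_upwards [eventually_ge_atTop i] with n hn
    rw [toSeq_apply φ hn, map_zero]; rfl)
  map_add' a b := by
    rw [← mk_add]
    refine mk_eq_mk ?_
    filter_upwards [eventually_ge_atTop i] with n hn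
    rw [toSeq_apply φ hn, map_add, ← toSeq_apply φ hn, ← toSeq_apply φ hn]; rfl
  commutes' c := by
    rw [Algebra.algebraMap_eq_smul_one, Algebra.algebraMap_eq_smul_one]
    refine Eq.trans ?_ (mk_smul c (1 : PreLim φ))
    refine mk_eq_mk ?_
    filter_upwards [eventually_ge_atTop i] with n hn
    rw [toSeq_apply φ hn, map_smul, map_one]; rfl
  map_star' a := by
    rw [← mk_star]
    refine mk_eq_mk ?_
    filter_upwards [eventually_ge_atTop i] with n hn
    rw [toSeq_apply φ hn, map_star, ← toSeq_apply φ hn]; rfl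

end CStarIndLim

/-! ### Simple C*-algebras, AH algebras, exponential length -/

/-- A C*-algebra is simple if it is nonzero and has no closed two-sided ideals besides `0` and
itself. -/
def IsSimpleCStar (A : Type*) [CStarAlgebra A] : Prop :=
  Nontrivial A ∧ ∀ I : TwoSidedIdeal A, IsClosed (I : Set A) → I = ⊥ ∨ I = ⊤

/-- `B` is isomorphic to a finite direct sum `⨁ⱼ pⱼ M_{dⱼ}(C(Xⱼ)) pⱼ` with `Xⱼ` compact metrizable
and `pⱼ` a projection in `M_{dⱼ}(C(Xⱼ)) = C(Xⱼ, M_{dⱼ}(ℂ))`. The direct sum is written as the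
corner `p M p` of `M = ∏ⱼ C(Xⱼ, M_{dⱼ}(ℂ))` cut by `p = (pⱼ)`. -/
def IsHomogeneousSum (B : Type*) [CStarAlgebra B] : Prop :=
  ∃ (r : ℕ) (X : Fin r → Type) (_ : ∀ j, TopologicalSpace (X j)) (_ : ∀ j, CompactSpace (X j))
    (_ : ∀ j, TopologicalSpace.MetrizableSpace (X j)) (d : Fin r → ℕ)
    (p : ∀ j, C(X j, Matrix (Fin (d j)) (Fin (d j)) ℂ))
    (θ : B →⋆ₙₐ[ℂ] ∀ j, C(X j, Matrix (Fin (d j)) (Fin (d j)) ℂ)),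
    IsStarProjection p ∧ Function.Injective θ ∧ Set.range θ = Set.range fun a => p * a * p

/-- A unital C*-algebra is an AH algebra if it is the inductive limit of a sequence of finite direct
sums of homogeneous algebras `p M_d(C(X)) p` (with unital connecting maps). -/
def IsAH (A : Type*) [CStarAlgebra A] : Prop :=
  ∃ (B : ℕ → Type) (_ : ∀ n, CStarAlgebra (B n)) (ψ : ∀ n, B n →⋆ₐ[ℂ] B (n + 1)),
    (∀ n, IsHomogeneousSum (B n)) ∧ Nonempty (A ≃⋆ₐ[ℂ] CStarIndLim.Lim ψ)

/-- `CU(A)`: the closure of the commutator subgroup of the unitary group `U(A)`. -/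
def CU (A : Type*) [CStarAlgebra A] : Subgroup (unitary A) :=
  (commutator (unitary A)).topologicalClosure

/-- The C*-exponential length: the infimum of `∑ ‖hⱼ‖` over all factorizations
`u = exp(i h₁) ⋯ exp(i hₘ)` with `hⱼ` self-adjoint. It is meant for `u` in the identity component
of `U(A)`; otherwise there is no factorization and the value is `sInf ∅ = 0`. -/
def cel {A : Type*} [CStarAlgebra A] (u : unitary A) : ℝ :=
  sInf {r : ℝ | ∃ l : List (selfAdjoint A),
    u = (l.map selfAdjoint.expUnitary).prod ∧ r = (l.map fun h => ‖(h : A)‖).sum}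

/-! ### The example -/

namespace AHExample

/-- The matrix size of the `n`-th algebra (counting from `0`). -/
def size (k : ℕ → ℕ) : ℕ → ℕ
  | 0 => 10
  | n + 1 => 10 ^ k n * size k n

/-- The `n`-th algebra (counting from `0`), `M_{size k n}(C[0,1]) = C([0,1], M_{size k n}(ℂ))`. So
`Stage k 0` is `M_10(C[0,1])` and `Stage k (n + 1)` is `M_{10 ^ k n}(Stage k n)`. -/
abbrev Stage (k : ℕ → ℕ) (n : ℕ) : Type :=
  C(unitInterval, Matrix (Fin (size k n)) (Fin (size k n)) ℂ)

/-- The block diagonal matrix `diag(c 0, …, c (m - 1))` in `M_m(M_L(ℂ)) = M_{mL}(ℂ)`. -/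
def blockDiag {m L : ℕ} (c : Fin m → Matrix (Fin L) (Fin L) ℂ) :
    Matrix (Fin (m * L)) (Fin (m * L)) ℂ :=
  (Matrix.blockDiagonal c).submatrix (fun i => (finProdFinEquiv.symm i).swap)
    (fun i => (finProdFinEquiv.symm i).swap)

theorem continuous_blockDiag {m L : ℕ} :
    Continuous (blockDiag : (Fin m → Matrix (Fin L) (Fin L) ℂ) → _) :=
  (Continuous.matrix_blockDiagonal continuous_id).matrix_submatrix _ _

theorem blockDiag_smul_one {m L : ℕ} (z : ℂ) :
    blockDiag (fun _ : Fin m => z • (1 : Matrix (Fin L) (Fin L) ℂ)) = z • 1 := by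
  have h : (fun _ : Fin m => z • (1 : Matrix (Fin L) (Fin L) ℂ)) = z • 1 := rfl
  rw [blockDiag, h, Matrix.blockDiagonal_smul, Matrix.blockDiagonal_one, Matrix.submatrix_smul]
  exact congrArg (z • ·) <| Matrix.submatrix_one (α := ℂ)
    (fun i : Fin (m * L) => (finProdFinEquiv.symm i).swap)
    (Prod.swap_injective.comp finProdFinEquiv.symm.injective)

theorem blockDiag_add {m L : ℕ} (c d : Fin m → Matrix (Fin L) (Fin L) ℂ) :
    blockDiag (c + d) = blockDiag c + blockDiag d := by
  rw [blockDiag, Matrix.blockDiagonal_add, Matrix.submatrix_add]; rfl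

theorem blockDiag_mul {m L : ℕ} (c d : Fin m → Matrix (Fin L) (Fin L) ℂ) :
    blockDiag (fun j => c j * d j) = blockDiag c * blockDiag d := by
  rw [blockDiag, Matrix.blockDiagonal_mul]
  exact (Matrix.submatrix_mul_equiv _ _ _
    (finProdFinEquiv.symm.trans (Equiv.prodComm (Fin m) (Fin L))) _).symm

theorem blockDiag_star {m L : ℕ} (c : Fin m → Matrix (Fin L) (Fin L) ℂ) :
    blockDiag (fun j => star (c j)) = star (blockDiag c) := by
  rw [Matrix.star_eq_conjTranspose, blockDiag, blockDiag, Matrix.conjTranspose_submatrix,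
    Matrix.blockDiagonal_conjTranspose]; rfl

/-- The connecting map `f ↦ diag(f, …, f, f(x n))` with `10 ^ k n` diagonal blocks, the last of
which is the constant function with value `f(x n)`. -/
def conn (x : ℕ → unitInterval) (k : ℕ → ℕ) (n : ℕ) : Stage k n →⋆ₐ[ℂ] Stage k (n + 1) where
  toFun f :=
    { toFun := fun t => blockDiag fun j : Fin (10 ^ k n) =>
        if (j : ℕ) + 1 = 10 ^ k n then f (x n) else f t
      continuous_toFun := continuous_blockDiag.comp (continuous_pi fun j => by
        split_ifs
        exacts [continuous_const, f.continuous]) }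
  map_one' := by
    ext1 t
    refine Eq.trans (congrArg blockDiag (funext fun j => ?_))
      ((blockDiag_smul_one 1).trans (one_smul _ _))
    simp
  map_mul' f g := by
    ext1 t
    refine Eq.trans (congrArg blockDiag (funext fun j => ?_)) (blockDiag_mul _ _)
    split_ifs <;> rfl
  map_zero' := by
    ext1 t
    refine Eq.trans (congrArg blockDiag (funext fun j => ?_))
      ((blockDiag_smul_one 0).trans (zero_smul _ _))
    simp
  map_add' f g := by
    ext1 t
    refine Eq.trans (congrArg blockDiag (funext fun j => ?_)) (blockDiag_add _ _)
    simp only [Pi.add_apply]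
    split_ifs <;> rfl
  commutes' c := by
    ext1 t
    rw [Algebra.algebraMap_eq_smul_one, Algebra.algebraMap_eq_smul_one]
    refine Eq.trans (congrArg blockDiag (funext fun j => ?_)) (blockDiag_smul_one c)
    simp
  map_star' f := by
    ext1 t
    refine Eq.trans (congrArg blockDiag (funext fun j => ?_)) (blockDiag_star _)
    split_ifs <;> rfl

/-- The inductive limit algebra. -/
abbrev LimAlg (x : ℕ → unitInterval) (k : ℕ → ℕ) : Type := CStarIndLim.Lim (conn x k)

/-- The diagonal entries of `u(t)`. -/
def uEntry (i : ℕ) (t : ℝ) : ℂ :=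
  if i = 0 then Complex.exp ((-(2 * Real.pi * t * (9 / 10)) : ℝ) * Complex.I)
  else Complex.exp ((2 * Real.pi * t * (1 / 10) : ℝ) * Complex.I)

theorem continuous_uEntry (i : ℕ) : Continuous (uEntry i) := by
  unfold uEntry
  split_ifs <;> fun_prop

theorem star_uEntry_mul (i : ℕ) (t : ℝ) : star (uEntry i t) * uEntry i t = 1 := by
  have h : ‖uEntry i t‖ = 1 := by
    unfold uEntry
    split_ifs <;> exact Complex.norm_exp_ofReal_mul_I _
  rw [Complex.star_def, ← Complex.normSq_eq_conj_mul_self, Complex.normSq_eq_norm_sq, h]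
  simp

/-- The unitary `u(t) = diag(e^{-2πit·9/10}, e^{2πit/10}, …, e^{2πit/10})` in `M_10(C[0,1])`. -/
def u (k : ℕ → ℕ) : unitary (Stage k 0) :=
  ⟨{ toFun := fun t => Matrix.diagonal fun i : Fin (size k 0) => uEntry i t
     continuous_toFun := Continuous.matrix_diagonal (continuous_pi fun i =>
      (continuous_uEntry i).comp continuous_subtype_val) }, by
    have h : ∀ (i : ℕ) (t : ℝ), uEntry i t * star (uEntry i t) = 1 := fun i t => by
      rw [mul_comm, star_uEntry_mul]
    rw [Unitary.mem_iff]
    constructor <;> ext1 t <;>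
      rw [ContinuousMap.mul_apply, ContinuousMap.star_apply, ContinuousMap.coe_mk,
        Matrix.star_eq_conjTranspose, Matrix.diagonal_conjTranspose, Matrix.diagonal_mul_diagonal,
        ContinuousMap.one_apply, ← Matrix.diagonal_one]
    · exact congrArg _ (funext fun i => star_uEntry_mul i t)
    · exact congrArg _ (funext fun i => h i t)⟩

/-- The image `φ_{1,∞}(u)` in the unitary group of the limit algebra. -/
def uLim (x : ℕ → unitInterval) (k : ℕ → ℕ) : unitary (LimAlg x k) :=
  ⟨CStarIndLim.toLim (conn x k) 0 (u k : Stage k 0), Unitary.map_mem _ (u k).2⟩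

end AHExample

end

/-! The length bound comes from following the total trace of a factorization along [0,1]. A
factorization of `uLim` of length below 2π·9/10 yields one at a finite stage n
(`exists_prod_expUnitary_eq_trans`), where u has become diag(e^{iα_j(t)}) of size L with ∑ α_j = 0.
Let T(t) be the sum of the traces of the exponents at t. Then e^{iT(t)} is the determinant, which is
1, so T is constant. The spectrum, however, confines T: if the exponents at t have total norm r,
then T(t) lies between the sum of the lifts of the eigenvalue angles to [-r, 2π-r) and the sum of
their lifts to (r-2π, r]. An index in the good set G runs from 1 to e^{2πi/10}; as r < 2π·9/10, its
lifts are 0 at t = 0 and 2π/10 at t = 1. Any other index has the same eigenvalue at both ends, and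
its two lifts differ by at most 2π. Hence 0 = T(1) - T(0) ≥ 2π(|G|/10 - (L - |G|)), that is
|G|·11/10 ≤ L. But |G| ≥ L·11/12 by the product hypothesis, and (11/12)(11/10) > 1.

Adding ‖g‖ to each exponent g reduces the confinement of T to positive exponents
(`HasAngles.sum_le_of_prod_exp`). These are multiplied in one eigenvector at a time. Each such
factor fixes a hyperplane, so it changes the number of angles in (a, 2π) by at most one
(`HasAngles.card_le`); integrating over a, the sum of the angles in [0, 2π) rises by less than 2π.
The determinant gives the rise modulo 2π, so it is at most the eigenvalue.

For simplicity, a nonzero element of an ideal is large on an open set, which contains some later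
x_j. The point evaluation at x_j turns it into a constant block, hence puts a nonzero constant
idempotent into the ideal, and the constant matrices form a simple unital subalgebra. Finally, u is
itself a commutator and a single exponential already in the first algebra. -/

/-! ### Angles of unitary matrices and traces of exponents -/

namespace Matrix

open Real

variable {n : Type*} [Fintype n] [DecidableEq n]

/-- `V` is unitarily equivalent to the diagonal matrix with entries `e ^ (i θ j)`. -/
def HasAngles (V : Matrix n n ℂ) (θ : n → ℝ) : Prop :=
  ∃ U ∈ unitary (Matrix n n ℂ),
    V = U * diagonal (fun i => Complex.exp (θ i * Complex.I)) * star U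

theorem hasAngles_diagonal (θ : n → ℝ) :
    HasAngles (diagonal fun i => Complex.exp (θ i * Complex.I)) θ :=
  ⟨1, one_mem _, by simp⟩

theorem HasAngles.det_eq {V : Matrix n n ℂ} {θ : n → ℝ} (h : HasAngles V θ) :
    V.det = Complex.exp ((∑ i, θ i : ℝ) * Complex.I) := by
  obtain ⟨U, hU, rfl⟩ := h
  rw [det_mul_right_comm, Unitary.mul_star_self_of_mem hU, one_mul, det_diagonal,
    ← Complex.exp_sum, ← Finset.sum_mul]
  push_cast
  rfl

theorem HasAngles.mem_unitary {V : Matrix n n ℂ} {θ : n → ℝ} (h : HasAngles V θ) :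
    V ∈ unitary (Matrix n n ℂ) := by
  obtain ⟨U, hU, rfl⟩ := h
  refine mul_mem (mul_mem hU ?_) (Unitary.star_mem hU)
  have (z : ℝ) : (starRingEnd ℂ) (Complex.exp (z * Complex.I)) * Complex.exp (z * Complex.I) = 1 := by
    rw [← Complex.exp_conj, ← Complex.exp_add]; simp
  rw [Unitary.mem_iff, star_eq_conjTranspose, diagonal_conjTranspose, diagonal_mul_diagonal,
    diagonal_mul_diagonal, ← diagonal_one]
  constructor <;> congr 1 <;> funext i
  · simpa using this (θ i)
  · simpa [mul_comm] using this (θ i)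

theorem HasAngles.congr {V : Matrix n n ℂ} {θ θ' : n → ℝ} (h : HasAngles V θ)
    (hθ : ∀ i, Complex.exp (θ i * Complex.I) = Complex.exp (θ' i * Complex.I)) :
    HasAngles V θ' := by
  obtain ⟨U, hU, rfl⟩ := h
  exact ⟨U, hU, by simp only [hθ]⟩

theorem exp_toIcoMod_mul_I (a b : ℝ) :
    Complex.exp ((toIcoMod two_pi_pos a b : ℝ) * Complex.I) = Complex.exp (b * Complex.I) := by
  rw [toIcoMod, Complex.exp_eq_exp_iff_exists_int]
  exact ⟨-toIcoDiv two_pi_pos a b, by push_cast [zsmul_eq_mul]; ring⟩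

/-- The exponential of `i H` for a Hermitian matrix `H`, diagonalised. -/
theorem IsHermitian.exp_eq {H : Matrix n n ℂ} (hH : H.IsHermitian) :
    NormedSpace.exp (Complex.I • H) = (hH.eigenvectorUnitary : Matrix n n ℂ) *
      diagonal (fun i => Complex.exp (hH.eigenvalues i * Complex.I)) *
      star (hH.eigenvectorUnitary : Matrix n n ℂ) := by
  have hU := hH.eigenvectorUnitary.2
  have hinv : (hH.eigenvectorUnitary : Matrix n n ℂ)⁻¹ = star (hH.eigenvectorUnitary : Matrix n n ℂ) :=
    inv_eq_left_inv (Unitary.star_mul_self_of_mem hU)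
  have hunit : IsUnit (hH.eigenvectorUnitary : Matrix n n ℂ) :=
    ⟨Unitary.toUnits hH.eigenvectorUnitary, rfl⟩
  conv_lhs => rw [hH.spectral_theorem, Unitary.conjStarAlgAut_apply]
  rw [← hinv, ← smul_mul_assoc, ← mul_smul_comm, exp_conj _ _ hunit, ← diagonal_smul, exp_diagonal]
  congr 3
  funext i
  simp [Pi.coe_exp, ← Complex.exp_eq_exp_ℂ, mul_comm]

theorem IsHermitian.hasAngles_exp {H : Matrix n n ℂ} (hH : H.IsHermitian) :
    HasAngles (NormedSpace.exp (Complex.I • H)) hH.eigenvalues :=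
  ⟨_, hH.eigenvectorUnitary.2, hH.exp_eq⟩

theorem IsHermitian.sum_eigenvalues_eq {H : Matrix n n ℂ} (hH : H.IsHermitian) :
    ∑ i, hH.eigenvalues i = H.trace.re := by
  rw [hH.trace_eq_sum_eigenvalues]; simp

/-- The spectrum is finite, so `Complex.arg` is continuous on it and the functional calculus gives a
Hermitian logarithm, which is then diagonalised. -/
theorem exists_hasAngles {V : Matrix n n ℂ} (hV : V ∈ unitary (Matrix n n ℂ)) :
    ∃ θ : n → ℝ, (∀ i, θ i ∈ Set.Ico 0 (2 * π)) ∧ HasAngles V θ := by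
  have hn : IsStarNormal V := isStarNormal_of_mem_unitary hV
  have hfin : (spectrum ℂ V).Finite := Matrix.finite_spectrum V
  have hc (f : ℂ → ℂ) : ContinuousOn f (spectrum ℂ V) := hfin.continuousOn f
  have hH : (cfc (fun z => (Complex.arg z : ℂ)) V).IsHermitian := IsSelfAdjoint.cfc_arg V
  have hVe : NormedSpace.exp (Complex.I • cfc (fun z => (Complex.arg z : ℂ)) V) = V := by
    rw [← CFC.exp_eq_normedSpace_exp (𝕜 := ℂ),
      ← cfc_smul _ _ _ (hc _), ← cfc_comp' _ _ _ (by fun_prop) (hc _)]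
    conv_rhs => rw [← cfc_id' ℂ V]
    refine cfc_congr fun y hy ↦ ?_
    have hy₁ : ‖y‖ = 1 := spectrum.norm_eq_one_of_unitary hV hy
    have : Complex.I * y.arg = Complex.log y :=
      Complex.ext (by simp [Complex.log_re, hy₁]) (by simp [Complex.log_im])
    have hy0 : y ≠ 0 := by rintro rfl; simp at hy₁
    simpa [← Complex.exp_eq_exp_ℂ, this] using Complex.exp_log hy0
  refine ⟨fun i => toIcoMod two_pi_pos 0 (hH.eigenvalues i), fun i => ?_, ?_⟩
  · simpa using toIcoMod_mem_Ico two_pi_pos 0 (hH.eigenvalues i)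
  · have h := hH.hasAngles_exp
    rw [hVe] at h
    exact h.congr fun i => (exp_toIcoMod_mul_I _ _).symm
-- A substitute for the min-max principle: after rotation by e^{-ib} the quadratic form of a unitary
-- has as real part a sum of cosines of its angles, weighted by the squared coordinates in its
-- eigenbasis.
theorem re_quadForm_unitary_conj (U : Matrix n n ℂ) (θ : n → ℝ) (b : ℝ) (x : n → ℂ) :
    (Complex.exp ((-b : ℝ) * Complex.I) * (star x ⬝ᵥ
      ((U * diagonal (fun i => Complex.exp (θ i * Complex.I)) * star U) *ᵥ x))).re =
    ∑ i, cos (θ i - b) * Complex.normSq ((star U *ᵥ x) i) := by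
  have h : star x ⬝ᵥ ((U * diagonal (fun i => Complex.exp (θ i * Complex.I)) * star U) *ᵥ x) =
      ∑ i, Complex.exp (θ i * Complex.I) * Complex.normSq ((star U *ᵥ x) i) := by
    have hU : star (star U *ᵥ x) = star x ᵥ* U := by
      rw [star_mulVec, ← star_eq_conjTranspose, star_star]
    rw [← mulVec_mulVec, ← mulVec_mulVec, dotProduct_mulVec, ← hU]
    simp only [dotProduct, mulVec_diagonal, Pi.star_apply]
    refine Finset.sum_congr rfl fun i _ => ?_
    rw [Complex.normSq_eq_conj_mul_self, Complex.star_def]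
    ring
  rw [h, Finset.mul_sum, Complex.re_sum]
  refine Finset.sum_congr rfl fun i _ => ?_
  rw [← mul_assoc, ← Complex.exp_add, ← add_mul, ← Complex.ofReal_add, Complex.re_mul_ofReal,
    Complex.exp_ofReal_mul_I_re, neg_add_eq_sub]

theorem sum_normSq_star_mulVec {U : Matrix n n ℂ} (hU : U ∈ unitary (Matrix n n ℂ)) (x : n → ℂ) :
    ∑ i, Complex.normSq ((star U *ᵥ x) i) = ∑ i, Complex.normSq (x i) := by
  have key (y : n → ℂ) : ((∑ i, Complex.normSq (y i) : ℝ) : ℂ) = star y ⬝ᵥ y := by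
    simp [dotProduct, Complex.normSq_eq_conj_mul_self]
  have : ((∑ i, Complex.normSq ((star U *ᵥ x) i) : ℝ) : ℂ) = (∑ i, Complex.normSq (x i) : ℝ) := by
    rw [key, key, star_mulVec, ← dotProduct_mulVec, mulVec_mulVec, ← star_eq_conjTranspose,
      star_star, Unitary.mul_star_self_of_mem hU, one_mulVec]
  exact_mod_cast this

/-- Two unitary matrices which agree on a hyperplane have, up to one, the same number of
eigenvalues on the arc from `e ^ (i a)` to `1`. -/
theorem HasAngles.card_le {V V' : Matrix n n ℂ} {θ θ' : n → ℝ} (h : HasAngles V θ)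
    (h' : HasAngles V' θ') (hθ : ∀ i, θ i ∈ Set.Ico 0 (2 * π))
    (hθ' : ∀ i, θ' i ∈ Set.Ico 0 (2 * π)) (g : (n → ℂ) →ₗ[ℂ] ℂ)
    (hg : ∀ y, g y = 0 → V' *ᵥ y = V *ᵥ y) {a : ℝ} (ha : 0 ≤ a) :
    (Finset.univ.filter fun i => a < θ' i).card ≤ (Finset.univ.filter fun i => a < θ i).card + 1 := by
  classical
  by_contra! hlt
  obtain ⟨U, hU, rfl⟩ := h
  obtain ⟨U', hU', rfl⟩ := h'
  -- The kernel of `f` consists of the vectors in the hyperplane that lie both in the span of the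
  -- eigenvectors of V' with angle > a and in that of V with angle ≤ a. If the claim fails, it is
  -- nonzero by dimension count.
  let f : (n → ℂ) →ₗ[ℂ] (({i // ¬ a < θ' i} → ℂ) × ({i // a < θ i} → ℂ)) × ℂ :=
    ((LinearMap.pi fun i => (LinearMap.proj i.1).comp (mulVecLin (star U'))).prod
      (LinearMap.pi fun i => (LinearMap.proj i.1).comp (mulVecLin (star U)))).prod g
  have hcard := Finset.card_filter_add_card_filter_not (s := (Finset.univ : Finset n))
    (fun i => a < θ' i)
  have hker : LinearMap.ker f ≠ ⊥ := by
    apply LinearMap.ker_ne_bot_of_finrank_lt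
    simp only [Module.finrank_prod, Module.finrank_fintype_fun_eq_card, Module.finrank_self,
      Fintype.card_subtype]
    rw [Finset.card_univ] at hcard
    omega
  obtain ⟨y, hy, hy0⟩ := (Submodule.ne_bot_iff _).1 hker
  have hf : f y = 0 := hy
  have h1 : ∀ i, ¬ a < θ' i → (star U' *ᵥ y) i = 0 := fun i hi =>
    congrFun (congrArg (fun p => p.1.1) hf) ⟨i, hi⟩
  have h2 : ∀ i, a < θ i → (star U *ᵥ y) i = 0 := fun i hi =>
    congrFun (congrArg (fun p => p.1.2) hf) ⟨i, hi⟩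
  have h3 := hg y (congrArg (fun p => p.2) hf)
  have hpos : 0 < ∑ i, Complex.normSq (y i) := by
    obtain ⟨i, hi⟩ := Function.ne_iff.1 hy0
    exact Finset.sum_pos' (fun i _ => Complex.normSq_nonneg _)
      ⟨i, Finset.mem_univ i, Complex.normSq_pos.2 hi⟩
  -- Rotation by a/2 centres the arc [0, a]: angles inside it have cosine at least cos(a/2), angles
  -- in (a, 2π) strictly less. As V and V' agree at y, the two forms are equal, a contradiction.
  have e1 := re_quadForm_unitary_conj U θ (a / 2) y
  rw [← h3, re_quadForm_unitary_conj U' θ' (a / 2) y] at e1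
  have l2 : cos (a / 2) * ∑ i, Complex.normSq (y i) ≤
      ∑ i, cos (θ i - a / 2) * Complex.normSq ((star U *ᵥ y) i) := by
    rw [← sum_normSq_star_mulVec hU, Finset.mul_sum]
    refine Finset.sum_le_sum fun i _ => ?_
    by_cases hi : a < θ i
    · simp [h2 i hi]
    · refine mul_le_mul_of_nonneg_right ?_ (Complex.normSq_nonneg _)
      rw [← cos_abs (θ i - a / 2)]
      by_cases ha' : a / 2 ≤ π
      · refine cos_le_cos_of_nonneg_of_le_pi (abs_nonneg _) ha' ?_
        rw [abs_le]; constructor <;> linarith [(hθ i).1]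
      -- Here a > 2π, so no angle of V' exceeds a and all coordinates of y vanish.
      · exfalso
        have hz : ∀ i, (star U' *ᵥ y) i = 0 := fun i => h1 i (by linarith [(hθ' i).2])
        have := sum_normSq_star_mulVec hU' y
        simp only [hz, map_zero, Finset.sum_const_zero] at this
        linarith
  have l1 : ∑ i, cos (θ' i - a / 2) * Complex.normSq ((star U' *ᵥ y) i) <
      cos (a / 2) * ∑ i, Complex.normSq (y i) := by
    have hcos : ∀ i, a < θ' i → cos (θ' i - a / 2) < cos (a / 2) := fun i hi => by
      have := (hθ' i).2
      rcases le_total (θ' i - a / 2) π with hle | hle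
      · exact cos_lt_cos_of_nonneg_of_le_pi (by linarith) hle (by linarith)
      · rw [← cos_two_pi_sub (θ' i - a / 2)]
        exact cos_lt_cos_of_nonneg_of_le_pi (by linarith) (by linarith) (by linarith)
    rw [← sum_normSq_star_mulVec hU', Finset.mul_sum]
    refine Finset.sum_lt_sum (fun i _ => ?_) ?_
    · by_cases hi : a < θ' i
      · exact mul_le_mul_of_nonneg_right (hcos i hi).le (Complex.normSq_nonneg _)
      · simp [h1 i hi]
    · rw [← sum_normSq_star_mulVec hU'] at hpos
      obtain ⟨i, -, hi⟩ := Finset.exists_ne_zero_of_sum_ne_zero hpos.ne'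
      have hi' : a < θ' i := by
        by_contra hc
        exact hi (by simp [h1 i hc])
      exact ⟨i, Finset.mem_univ i, mul_lt_mul_of_pos_right (hcos i hi')
        (lt_of_le_of_ne (Complex.normSq_nonneg _) (Ne.symm hi))⟩
  linarith

theorem integral_indicator_lt {M c : ℝ} (hc : 0 ≤ c) (hcM : c ≤ M) :
    ∫ a in (0 : ℝ)..M, (if a < c then (1 : ℝ) else 0) = c := by
  have : (fun a : ℝ => if a < c then (1 : ℝ) else 0) = Set.indicator (Set.Iio c) 1 := by
    funext a; simp [Set.indicator_apply]
  rw [this, intervalIntegral.integral_of_le (hc.trans hcM),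
    MeasureTheory.integral_indicator_one measurableSet_Iio, MeasureTheory.measureReal_restrict_apply measurableSet_Iio]
  have : Set.Iio c ∩ Set.Ioc 0 M = Set.Ioo 0 c := by
    ext a; simp only [Set.mem_inter_iff, Set.mem_Iio, Set.mem_Ioc, Set.mem_Ioo]
    constructor
    · rintro ⟨h1, h2, h3⟩; exact ⟨h2, h1⟩
    · rintro ⟨h1, h2⟩; exact ⟨h2, h1, by linarith⟩
  rw [this]; simp [hc]

theorem intervalIntegrable_indicator_lt (M c : ℝ) :
    IntervalIntegrable (fun a : ℝ => if a < c then (1 : ℝ) else 0) MeasureTheory.volume 0 M := by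
  have : Antitone (fun a : ℝ => if a < c then (1 : ℝ) else 0) := fun a b hab => by
    dsimp only
    split_ifs <;> linarith
  exact this.intervalIntegrable

theorem intervalIntegrable_sum_indicator_lt {ι : Type*} [Fintype ι] (M : ℝ) (θ : ι → ℝ) :
    IntervalIntegrable (fun a : ℝ => ∑ i, if a < θ i then (1 : ℝ) else 0)
      MeasureTheory.volume 0 M := by
  have : Antitone (fun a : ℝ => ∑ i, if a < θ i then (1 : ℝ) else 0) := fun a b hab =>
    Finset.sum_le_sum fun i _ => by split_ifs <;> linarith
  exact this.intervalIntegrable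

/-- If, for each `a ≥ 0`, at most one more of the `θ' i` than of the `θ i` exceeds `a`, then
`∑ θ' i < ∑ θ i + c` for each positive strict upper bound `c` of the `θ' i`. -/
theorem sum_lt_of_card_le {ι : Type*} [Fintype ι] {θ θ' : ι → ℝ} {c : ℝ} (hc : 0 < c) (hθ : ∀ i, 0 ≤ θ i)
    (hθ' : ∀ i, θ' i ∈ Set.Ico 0 c)
    (h : ∀ a, 0 ≤ a → (Finset.univ.filter fun i => a < θ' i).card ≤
      (Finset.univ.filter fun i => a < θ i).card + 1) :
    ∑ i, θ' i < ∑ i, θ i + c := by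
  -- Integrating the counting functions only up to the maximum M < c of the θ' is what makes the
  -- inequality strict.
  obtain ⟨M, hM0, hMc, hM⟩ : ∃ M, 0 ≤ M ∧ M < c ∧ ∀ i, θ' i ≤ M := by
    rcases isEmpty_or_nonempty ι with hn | hn
    · exact ⟨0, le_rfl, hc, fun i => isEmptyElim i⟩
    · obtain ⟨j, hj⟩ := Finite.exists_max θ'
      exact ⟨θ' j, (hθ' j).1, (hθ' j).2, hj⟩
  have e1 : ∑ i, θ' i = ∫ a in (0 : ℝ)..M, ∑ i, (if a < θ' i then (1 : ℝ) else 0) := by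
    rw [intervalIntegral.integral_finsetSum fun i _ => intervalIntegrable_indicator_lt M _]
    exact Finset.sum_congr rfl fun i _ => (integral_indicator_lt (hθ' i).1 (hM i)).symm
  have e2 : ∫ a in (0 : ℝ)..M, ((∑ i, (if a < min (θ i) M then (1 : ℝ) else 0)) + 1) =
      ∑ i, min (θ i) M + M := by
    rw [intervalIntegral.integral_add, intervalIntegral.integral_finsetSum
      fun i _ => intervalIntegrable_indicator_lt M _]
    · simp_rw [integral_indicator_lt (le_min (hθ _) hM0) (min_le_right _ _)]
      simp
    · exact intervalIntegrable_sum_indicator_lt M _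
    · simp
  have e3 : ∑ i, θ' i ≤ ∑ i, min (θ i) M + M := by
    rw [e1, ← e2]
    refine intervalIntegral.integral_mono_on_of_le_Ioo hM0
      (intervalIntegrable_sum_indicator_lt M _)
      ((intervalIntegrable_sum_indicator_lt M _).add _root_.intervalIntegrable_const) ?_
    intro a ha
    have := h a ha.1.le
    have hh : ∀ i, (a < min (θ i) M) = (a < θ i) := fun i => by simp [ha.2]
    simp only [hh, Finset.sum_boole]
    exact_mod_cast this
  have e4 : ∑ i, min (θ i) M ≤ ∑ i, θ i := Finset.sum_le_sum fun i _ => min_le_left _ _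
  linarith

/-- Multiplying by a unitary which fixes a hyperplane and has determinant `e ^ (i μ)`, `μ ≥ 0`,
increases the sum of the angles in `[0, 2π)` by at most `μ`. -/
theorem HasAngles.sum_le_of_fix_hyperplane {V V' : Matrix n n ℂ} {θ θ' : n → ℝ} (h : HasAngles V θ)
    (h' : HasAngles V' θ') (hθ : ∀ i, θ i ∈ Set.Ico 0 (2 * π))
    (hθ' : ∀ i, θ' i ∈ Set.Ico 0 (2 * π)) (g : (n → ℂ) →ₗ[ℂ] ℂ)
    (hg : ∀ y, g y = 0 → V' *ᵥ y = V *ᵥ y) {μ : ℝ} (hμ : 0 ≤ μ)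
    (hdet : V'.det = V.det * Complex.exp (μ * Complex.I)) :
    ∑ i, θ' i ≤ ∑ i, θ i + μ := by
  have hlt := sum_lt_of_card_le two_pi_pos (fun i => (hθ i).1) hθ'
    fun a ha => h.card_le h' hθ hθ' g hg ha
  rw [h.det_eq, h'.det_eq, ← Complex.exp_add, ← add_mul, ← Complex.ofReal_add,
    Complex.exp_eq_exp_iff_exists_int] at hdet
  obtain ⟨m, hm⟩ := hdet
  have hm' : ∑ i, θ' i = ∑ i, θ i + μ + m * (2 * π) := by
    have := congrArg Complex.im hm
    simpa using this
  -- The sums differ by μ + 2πm, which is less than 2π; since μ ≥ 0, this excludes m ≥ 1.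
  have hm0 : m ≤ 0 := by
    by_contra! hc
    have : (1 : ℝ) ≤ m := by exact_mod_cast hc
    nlinarith [pi_pos]
  have : (m : ℝ) ≤ 0 := by exact_mod_cast hm0
  nlinarith [pi_pos]

/-! ### Trace bounds for products of exponentials -/

open scoped ComplexOrder

theorem star_list_prod {R : Type*} [Monoid R] [StarMul R] (l : List R) :
    star l.prod = (l.reverse.map star).prod := by
  induction l with
  | nil => simp
  | cons a l ih => simp [ih]

theorem det_unitary_conj {U : Matrix n n ℂ} (hU : U ∈ unitary (Matrix n n ℂ)) (D : Matrix n n ℂ) :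
    (U * D * star U).det = D.det := by
  rw [det_mul_right_comm, Unitary.mul_star_self_of_mem hU, one_mul]

/-- Multiplying by `e ^ (i p)` with `p ≥ 0` increases the sum of the angles in `[0, 2π)` by at
most the trace of `p`. -/
theorem HasAngles.sum_le_mul_exp {V p : Matrix n n ℂ} {θ θ' : n → ℝ} (h : HasAngles V θ)
    (hp : p.PosSemidef) (h' : HasAngles (V * NormedSpace.exp (Complex.I • p)) θ')
    (hθ : ∀ i, θ i ∈ Set.Ico 0 (2 * π)) (hθ' : ∀ i, θ' i ∈ Set.Ico 0 (2 * π)) :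
    ∑ i, θ' i ≤ ∑ i, θ i + p.trace.re := by
  classical
  set U : Matrix n n ℂ := (hp.isHermitian.eigenvectorUnitary : Matrix n n ℂ)
  have hU : U ∈ unitary (Matrix n n ℂ) := hp.isHermitian.eigenvectorUnitary.2
  set μ := hp.isHermitian.eigenvalues
  -- Only the eigenvalues indexed by `s` are exponentiated. Enlarging `s` by j changes the product
  -- only off the hyperplane where the j-th eigencoordinate vanishes.
  let d : Finset n → n → ℂ := fun s i => if i ∈ s then Complex.exp (μ i * Complex.I) else 1
  have hd (s : Finset n) : d s = fun i => Complex.exp ((if i ∈ s then μ i else 0 : ℝ) * Complex.I) := by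
    funext i
    by_cases hi : i ∈ s <;> simp [d, hi]
  have hTU (s : Finset n) : U * diagonal (d s) * star U ∈ unitary (Matrix n n ℂ) :=
    HasAngles.mem_unitary (θ := fun i => if i ∈ s then μ i else 0) ⟨U, hU, by rw [hd s]⟩
  have key : ∀ s : Finset n, ∀ θ' : n → ℝ, (∀ i, θ' i ∈ Set.Ico 0 (2 * π)) →
      HasAngles (V * (U * diagonal (d s) * star U)) θ' → ∑ i, θ' i ≤ ∑ i, θ i + ∑ i ∈ s, μ i := by
    intro s
    induction s using Finset.induction_on with
    | empty =>
      intro θ' hθ' h'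
      have h1 : d ∅ = fun _ => 1 := by funext i; simp [d]
      rw [h1, diagonal_one, mul_one, Unitary.mul_star_self_of_mem hU, mul_one] at h'
      simpa using h.sum_le_of_fix_hyperplane h' hθ hθ' 0 (fun _ _ => rfl) le_rfl (by simp)
    | insert j s hj ih =>
      intro θ' hθ' h'
      obtain ⟨θ'', hθ'', h''⟩ := exists_hasAngles (mul_mem h.mem_unitary (hTU s))
      have := h''.sum_le_of_fix_hyperplane h' hθ'' hθ'
        ((LinearMap.proj j).comp (mulVecLin (star U))) (fun y hy => ?_)
        (hp.eigenvalues_nonneg j) ?_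
      · rw [Finset.sum_insert hj]
        linarith [ih θ'' hθ'' h'']
      · have hy : (star U *ᵥ y) j = 0 := hy
        rw [← mulVec_mulVec, ← mulVec_mulVec, ← mulVec_mulVec, ← mulVec_mulVec, ← mulVec_mulVec,
          ← mulVec_mulVec]
        congr 2
        funext i
        simp only [mulVec_diagonal]
        by_cases hij : i = j
        · rw [hij, hy, mul_zero, mul_zero]
        · simp [d, hij]
      · rw [det_mul, det_mul V, det_unitary_conj hU, det_unitary_conj hU, det_diagonal, det_diagonal,
          mul_assoc]
        congr 1
        simp only [d, Finset.prod_ite_mem, Finset.univ_inter]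
        rw [Finset.prod_insert hj, mul_comm]
  rw [← hp.isHermitian.sum_eigenvalues_eq]
  refine key Finset.univ θ' hθ' ?_
  rw [hp.isHermitian.exp_eq] at h'
  simpa [d] using h'

/-- If `V = e ^ (i p₁) ⋯ e ^ (i pₘ)` with `pⱼ ≥ 0`, then the sum of the angles of `V` in `[0, 2π)`
is at most `∑ tr pⱼ`. -/
theorem HasAngles.sum_le_of_prod_exp (l : List (Matrix n n ℂ)) (hl : ∀ p ∈ l, p.PosSemidef)
    {θ : n → ℝ} (hθ : ∀ i, θ i ∈ Set.Ico 0 (2 * π))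
    (h : HasAngles (l.map fun p => NormedSpace.exp (Complex.I • p)).prod θ) :
    ∑ i, θ i ≤ (l.map fun p => p.trace.re).sum := by
  induction l using List.reverseRecOn generalizing θ with
  | nil =>
    have h0 : HasAngles (1 : Matrix n n ℂ) 0 := ⟨1, one_mem _, by simp⟩
    have := h0.sum_le_of_fix_hyperplane h (fun i => ⟨le_rfl, two_pi_pos⟩) hθ 0 (fun _ _ => rfl)
      le_rfl (by simp)
    simpa using this
  | append_singleton l p ih =>
    have hu : (l.map fun p => NormedSpace.exp (Complex.I • p)).prod ∈ unitary (Matrix n n ℂ) := by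
      refine list_prod_mem fun x hx => ?_
      obtain ⟨q, hq, rfl⟩ := List.mem_map.1 hx
      exact (hl q (by simp [hq])).isHermitian.hasAngles_exp.mem_unitary
    obtain ⟨θ', hθ', h'⟩ := exists_hasAngles hu
    rw [List.map_append, List.prod_append] at h
    have h1 := h'.sum_le_mul_exp (hl p (by simp)) (by simpa using h) hθ' hθ
    have h2 := ih (fun q hq => hl q (by simp [hq])) hθ' h'
    simp only [List.map_append, List.sum_append, List.map_cons, List.map_nil, List.sum_singleton]
    linarith

theorem posSemidef_add_norm_smul_one {g : Matrix n n ℂ} (hg : g.IsHermitian) {r : ℝ} (hr : ‖g‖ ≤ r) :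
    (g + (r : ℂ) • 1).PosSemidef := by
  have hH : (g + (r : ℂ) • 1).IsHermitian := hg.add (by
    rw [IsHermitian, conjTranspose_smul, conjTranspose_one]; simp)
  rw [hH.posSemidef_iff_eigenvalues_nonneg]
  intro i
  have h1 := hH.eigenvalues_mem_spectrum_real i
  have h2 : -r + hH.eigenvalues i ∈ spectrum ℝ g := by
    rw [add_comm, spectrum.add_mem_iff]
    convert h1 using 1
    rw [Algebra.algebraMap_eq_smul_one, neg_smul, neg_neg, add_comm]
    rfl
  have : Nonempty n := ⟨i⟩
  have h3 := (spectrum.norm_le_norm_of_mem h2).trans hr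
  rw [Real.norm_eq_abs, abs_le] at h3
  simp only [Pi.zero_apply]
  linarith [h3.1]

theorem exp_I_smul_add_smul_one (g : Matrix n n ℂ) (r : ℝ) :
    NormedSpace.exp (Complex.I • (g + (r : ℂ) • (1 : Matrix n n ℂ))) =
      Complex.exp (r * Complex.I) • NormedSpace.exp (Complex.I • g) := by
  rw [smul_add, smul_smul, ← Algebra.algebraMap_eq_smul_one, exp_add_of_commute _ _
    (Algebra.commute_algebraMap_right _ _), ← NormedSpace.algebraMap_exp_comm,
    ← Complex.exp_eq_exp_ℂ, Algebra.algebraMap_eq_smul_one, mul_smul_one, mul_comm]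

/-- If `diag (e ^ (i α)) = e ^ (i g₁) ⋯ e ^ (i gₘ)` with `∑ ‖gⱼ‖ = r`, then `∑ tr gⱼ` is at
least the sum of the lifts of the eigenvalues to `[-r, 2π - r)`. -/
theorem sum_toIcoMod_le_of_prod_exp (l : List (Matrix n n ℂ)) (hl : ∀ g ∈ l, g.IsHermitian)
    {r : ℝ} (hr : r = (l.map fun g => ‖g‖).sum) (α : n → ℝ)
    (h : (l.map fun g => NormedSpace.exp (Complex.I • g)).prod =
      diagonal fun i => Complex.exp (α i * Complex.I)) :
    ∑ i, toIcoMod two_pi_pos (-r) (α i) ≤ (l.map fun g => g.trace.re).sum := by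
  -- The shift makes every exponent positive; it multiplies the product by e^{ir} and adds r times
  -- the dimension to the trace. The angles of the new product in [0, 2π) are the lifts to [-r, 2π -
  -- r) plus r.
  let l' := l.map fun g => g + (‖g‖ : ℂ) • (1 : Matrix n n ℂ)
  have e1 : (l'.map fun p => NormedSpace.exp (Complex.I • p)).prod =
      Complex.exp (r * Complex.I) • (l.map fun g => NormedSpace.exp (Complex.I • g)).prod := by
    rw [hr]
    clear hr h hl
    induction l with
    | nil => simp [l']
    | cons g l ih =>
      simp only [l', List.map_cons, List.prod_cons, List.sum_cons, List.map_map] at ih ⊢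
      rw [ih, exp_I_smul_add_smul_one, smul_mul_smul_comm, ← Complex.exp_add]
      push_cast
      rw [add_mul]
  have e2 : (l'.map fun p => p.trace.re).sum =
      (l.map fun g => g.trace.re).sum + Fintype.card n * r := by
    rw [hr]
    clear hr h hl e1
    induction l with
    | nil => simp [l']
    | cons g l ih =>
      simp only [l', List.map_cons, List.sum_cons, List.map_map] at ih ⊢
      rw [ih, trace_add, trace_smul, trace_one]
      simp
      ring
  have e3 := HasAngles.sum_le_of_prod_exp l' (fun p hp => by
      obtain ⟨g, hg, rfl⟩ := List.mem_map.1 hp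
      exact posSemidef_add_norm_smul_one (hl g hg) le_rfl)
    (θ := fun i => toIcoMod two_pi_pos (-r) (α i) + r) (fun i => by
      have := toIcoMod_mem_Ico two_pi_pos (-r) (α i)
      constructor <;> linarith [this.1, this.2]) (by
      rw [e1, h, ← diagonal_smul]
      convert! hasAngles_diagonal (n := n) _ using 3 with i
      push_cast
      rw [add_mul, Complex.exp_add, exp_toIcoMod_mul_I, Pi.smul_apply, smul_eq_mul, mul_comm])
  rw [e2, Finset.sum_add_distrib] at e3
  simpa using e3

/-- The counterpart of `sum_toIcoMod_le_of_prod_exp` for lifts to `(r - 2π, r]`, written as the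
negatives of the lifts of `e ^ (-i α)` to `[-r, 2π - r)`. -/
theorem sum_toIcoMod_neg_le_of_prod_exp (l : List (Matrix n n ℂ)) (hl : ∀ g ∈ l, g.IsHermitian)
    {r : ℝ} (hr : r = (l.map fun g => ‖g‖).sum) (α : n → ℝ)
    (h : (l.map fun g => NormedSpace.exp (Complex.I • g)).prod =
      diagonal fun i => Complex.exp (α i * Complex.I)) :
    ∑ i, toIcoMod two_pi_pos (-r) (-α i) ≤ -(l.map fun g => g.trace.re).sum := by
  -- Taking adjoints reverses the product and negates the exponents.
  have h1 := sum_toIcoMod_le_of_prod_exp (l.reverse.map fun g => -g) (fun p hp => by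
      obtain ⟨g, hg, rfl⟩ := List.mem_map.1 hp
      exact (hl g (by simpa using hg)).neg) (r := r) (by
      rw [hr, List.map_map, List.map_reverse, List.sum_reverse]
      simp [Function.comp_def]) (fun i => -α i) (by
      have := congrArg star h
      rw [star_eq_conjTranspose (diagonal _), diagonal_conjTranspose, star_list_prod,
        List.map_reverse, List.map_map] at this
      convert! this using 2
      · rw [List.map_map, List.map_reverse]
        refine congrArg List.reverse (List.map_congr_left fun g hg => ?_)
        rw [Function.comp_apply, Function.comp_apply, NormedSpace.star_exp, star_smul,
          star_eq_conjTranspose, (hl g hg).eq]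
        simp
      · funext i
        rw [Pi.star_apply, Complex.star_def, ← Complex.exp_conj]
        simp)
  rw [List.map_map, List.map_reverse, List.sum_reverse] at h1
  refine h1.trans (le_of_eq ?_)
  rw [← Multiset.sum_coe, ← Multiset.sum_coe, ← Multiset.map_coe, ← Multiset.map_coe,
    ← Multiset.sum_map_neg]
  simp

end Matrix

/-! ### Exponentials of self-adjoint elements -/

section StarAlgHom

variable {A B : Type*} [CStarAlgebra A] [CStarAlgebra B]

/-- The image of a self-adjoint element under a `*`-homomorphism. -/
def StarAlgHom.mapSelfAdjoint (f : A →⋆ₐ[ℂ] B) (h : selfAdjoint A) : selfAdjoint B :=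
  ⟨f h, IsSelfAdjoint.map h.2 f⟩

theorem StarAlgHom.map_expUnitary (f : A →⋆ₐ[ℂ] B) (h : selfAdjoint A) :
    f (selfAdjoint.expUnitary h : A) = selfAdjoint.expUnitary (f.mapSelfAdjoint h) := by
  let _ : NormedAlgebra ℚ A := .restrictScalars ℚ ℂ A
  let _ : NormedAlgebra ℚ B := .restrictScalars ℚ ℂ B
  have hf : Continuous f := AddMonoidHomClass.continuous_of_bound f 1 fun a => by
    simpa using NonUnitalStarAlgHom.norm_apply_le f a
  rw [selfAdjoint.expUnitary_coe, selfAdjoint.expUnitary_coe, NormedSpace.map_exp f hf, map_smul]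
  rfl

theorem StarAlgHom.map_prod_expUnitary (f : A →⋆ₐ[ℂ] B) (l : List (selfAdjoint A)) :
    f ((l.map selfAdjoint.expUnitary).prod : unitary A) =
      (((l.map f.mapSelfAdjoint).map selfAdjoint.expUnitary).prod : unitary B) := by
  induction l with
  | nil => simp
  | cons h l ih =>
    simp only [List.map_cons, List.prod_cons, Submonoid.coe_mul, map_mul, ih, f.map_expUnitary]

theorem StarAlgHom.sum_norm_mapSelfAdjoint_le (f : A →⋆ₐ[ℂ] B) (l : List (selfAdjoint A)) :
    ((l.map f.mapSelfAdjoint).map fun h : selfAdjoint B => ‖(h : B)‖).sum ≤ (l.map fun h : selfAdjoint A => ‖(h : A)‖).sum := by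
  rw [List.map_map]
  exact List.sum_le_sum fun h _ => NonUnitalStarAlgHom.norm_apply_le f (h : A)

theorem coe_prod_expUnitary (l : List (selfAdjoint A)) :
    (((l.map selfAdjoint.expUnitary).prod : unitary A) : A) =
      ((l.map Subtype.val).map fun g => NormedSpace.exp (Complex.I • g)).prod := by
  induction l with
  | nil => simp
  | cons h l ih =>
    simp only [List.map_cons, List.prod_cons, Submonoid.coe_mul, ih, selfAdjoint.expUnitary_coe]

theorem continuous_expUnitary : Continuous (selfAdjoint.expUnitary : selfAdjoint A → unitary A) := by
  fun_prop

theorem unitary_norm_mul_sub_mul_le (u v u' v' : unitary A) :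
    ‖((u * v : unitary A) : A) - (u' * v' : unitary A)‖ ≤ ‖(u : A) - u'‖ + ‖(v : A) - v'‖ := by
  have : ((u * v : unitary A) : A) - (u' * v' : unitary A) = (u : A) * (v - v') + (u - u') * v' := by
    push_cast; noncomm_ring
  rw [this]
  refine (norm_add_le _ _).trans ?_
  rw [CStarRing.norm_coe_unitary_mul, CStarRing.norm_mul_coe_unitary, add_comm]

/-- A unitary near `1` is the exponential of a small self-adjoint element, uniformly. -/
theorem exists_expUnitary_eq_of_near_one {ε : ℝ} (hε : 0 < ε) :
    ∃ δ > 0, ∀ (A : Type*) [CStarAlgebra A] (u : unitary A), ‖(u : A) - 1‖ < δ →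
      ∃ h : selfAdjoint A, selfAdjoint.expUnitary h = u ∧ ‖(h : A)‖ < ε := by
  -- For ‖u - 1‖ < 2 the principal logarithm of u has norm arccos(1 - ‖u - 1‖²/2). This depends on
  -- ‖u - 1‖ alone, so δ does not depend on the algebra.
  have hc : ContinuousAt (fun y : ℝ => Real.arccos (1 - y ^ 2 / 2)) 0 := by fun_prop
  obtain ⟨δ, hδ, h⟩ := Metric.continuousAt_iff.1 hc ε hε
  refine ⟨min δ 2, by positivity, fun A _ u hu => ?_⟩
  have hu2 : ‖(u : A) - 1‖ < 2 := hu.trans_le (min_le_right _ _)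
  refine ⟨Unitary.argSelfAdjoint u, expUnitary_argSelfAdjoint hu2, ?_⟩
  have h1 := @h ‖(u : A) - 1‖ (by simpa using hu.trans_le (min_le_left _ _))
  have h2 := Unitary.norm_argSelfAdjoint hu2
  have h3 : ‖(Unitary.argSelfAdjoint u : A)‖ = Real.arccos (1 - ‖(u - 1 : A)‖ ^ 2 / 2) := h2
  rw [h3]
  simpa [Real.dist_eq, abs_of_nonneg (Real.arccos_nonneg _)] using h1

end StarAlgHom

/-! ### Descending from the limit to a finite stage -/

namespace CStarIndLim

open Filter Topology

variable {B : ℕ → Type*} [∀ n, CStarAlgebra (B n)] (φ : ∀ n, B n →⋆ₐ[ℂ] B (n + 1))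

theorem trans_self (i : ℕ) (a : B i) : trans φ i le_rfl a = a := by
  have := Nat.leRec_self (motive := fun n _ => B i →⋆ₐ[ℂ] B n) (StarAlgHom.id ℂ (B i))
    (fun n _ f => (φ n).comp f)
  exact congrArg (fun f : B i →⋆ₐ[ℂ] B i => f a) this

theorem trans_trans {i j n : ℕ} (hij : i ≤ j) (hjn : j ≤ n) (a : B i) :
    trans φ j hjn (trans φ i hij a) = trans φ i (hij.trans hjn) a := by
  induction n, hjn using Nat.le_induction with
  | base => rw [trans_self]
  | succ n hn ih => rw [trans_succ φ j hn, trans_succ φ i (hij.trans hn), ih]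

theorem toLim_trans {i n : ℕ} (h : i ≤ n) (a : B i) :
    toLim φ n (trans φ i h a) = toLim φ i a := by
  refine mk_eq_mk ?_
  filter_upwards [eventually_ge_atTop n] with m hm
  rw [toSeq_apply φ hm, toSeq_apply φ (h.trans hm), trans_trans]

theorem exists_mk_eq_toLim (a : PreLim φ) : ∃ N, ∀ n, N ≤ n → mk a = toLim φ n (a.1 n) := by
  obtain ⟨N, hN⟩ := eventually_atTop.1 a.2
  refine ⟨N, fun n hn => mk_eq_mk ?_⟩
  filter_upwards [eventually_ge_atTop n] with m hm
  rw [toSeq_apply φ hm]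
  induction m, hm using Nat.le_induction with
  | base => rw [trans_self]
  | succ m hm ih => rw [trans_succ φ n hm, ← ih, hN m (hn.trans hm)]

theorem tendsto_norm_toSeq (i : ℕ) (a : B i) :
    Tendsto (fun n => ‖(toSeq φ i a).1 n‖) atTop (𝓝 ‖toLim φ i a‖) := by
  have : ‖toLim φ i a‖ = lnorm (toSeq φ i a) := norm_mk _
  rw [this]
  exact tendsto_lnorm _

theorem exists_norm_trans_lt {i : ℕ} {a : B i} {r : ℝ} (h : ‖toLim φ i a‖ < r) :
    ∃ n, ∃ hn : i ≤ n, ‖trans φ i hn a‖ < r := by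
  obtain ⟨n, h1, h2⟩ := (((tendsto_norm_toSeq φ i a).eventually_lt_const h).and
    (eventually_ge_atTop i)).exists
  exact ⟨n, h2, by rwa [toSeq_apply φ h2] at h1⟩

/-- Elements of the limit are approximated by elements of all sufficiently late stages, with
control on the norm there. -/
theorem exists_approx (a : Lim φ) {ε : ℝ} (hε : 0 < ε) :
    ∃ N, ∀ n, N ≤ n → ∃ b : B n, ‖toLim φ n b - a‖ < ε ∧ ‖b‖ < ‖a‖ + ε := by
  obtain ⟨c, hc⟩ := Metric.denseRange_iff.1 (denseRange_mk (φ := φ)) a (ε / 2) (by positivity)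
  rw [dist_comm, dist_eq_norm] at hc
  obtain ⟨N, hN⟩ := exists_mk_eq_toLim φ c
  have h1 : lnorm c < ‖a‖ + ε := by
    have : lnorm c = ‖mk c‖ := (norm_mk c).symm
    rw [this]
    linarith [norm_le_norm_add_norm_sub' (mk c) a]
  obtain ⟨N', hN'⟩ := eventually_atTop.1 ((tendsto_lnorm c).eventually_lt_const h1)
  refine ⟨max N N', fun n hn => ⟨c.1 n, ?_, hN' n (by omega)⟩⟩
  rw [← hN n (by omega)]
  linarith

theorem exists_selfAdjoint_approx (a : selfAdjoint (Lim φ)) {ε : ℝ} (hε : 0 < ε) :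
    ∃ N, ∀ n, N ≤ n → ∃ b : selfAdjoint (B n),
      ‖toLim φ n (b : B n) - a‖ < ε ∧ ‖(b : B n)‖ < ‖(a : Lim φ)‖ + ε := by
  obtain ⟨N, hN⟩ := exists_approx φ (a : Lim φ) hε
  refine ⟨N, fun n hn => ?_⟩
  obtain ⟨b, hb1, hb2⟩ := hN n hn
  refine ⟨realPart b, ?_, ?_⟩
  -- The error of the real part is the average of the error of b and its adjoint.
  · have hh : toLim φ n (realPart b : B n) - a = ((1 / 2 : ℂ)) • ((toLim φ n b - a) + star (toLim φ n b - a)) := by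
      rw [realPart_apply_coe, ← Complex.coe_smul, map_smul, map_add, map_star, star_sub, a.2.star_eq]
      have : (a : Lim φ) = (1 / 2 : ℂ) • ((a : Lim φ) + a) := by
        rw [← two_smul ℂ (a : Lim φ), smul_smul]; norm_num
      nth_rewrite 1 [this]
      push_cast
      rw [one_div, ← smul_sub]
      congr 1
      abel
    rw [hh, norm_smul]
    have := norm_add_le (toLim φ n b - a) (star (toLim φ n b - a))
    rw [norm_star] at this
    have h2 : ‖(1 / 2 : ℂ)‖ = 1 / 2 := by norm_num
    rw [h2]
    linarith
  · exact (realPart.norm_le b).trans_lt hb2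

/-- Each exponent is approximated separately. As all factors are unitary, the errors of the factors
add up without amplification. -/
theorem exists_prod_expUnitary_approx (l : List (selfAdjoint (Lim φ))) {ε : ℝ} (hε : 0 < ε) :
    ∃ N, ∀ n, N ≤ n → ∃ l' : List (selfAdjoint (B n)),
      ‖toLim φ n ((l'.map selfAdjoint.expUnitary).prod : unitary (B n)) -
        ((l.map selfAdjoint.expUnitary).prod : unitary (Lim φ))‖ < ε ∧
      (l'.map fun h : selfAdjoint (B n) => ‖(h : B n)‖).sum < (l.map fun h : selfAdjoint (Lim φ) => ‖(h : Lim φ)‖).sum + ε := by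
  induction l generalizing ε with
  | nil => exact ⟨0, fun n _ => ⟨[], by simpa using hε, by simpa using hε⟩⟩
  | cons h l ih =>
    have hc : Continuous fun h : selfAdjoint (Lim φ) => (selfAdjoint.expUnitary h : Lim φ) :=
      continuous_subtype_val.comp continuous_expUnitary
    obtain ⟨δ, hδ, hδ'⟩ := Metric.continuous_iff.1 hc h (ε / 2) (by positivity)
    obtain ⟨N, hN⟩ := ih (ε := ε / 2) (by positivity)
    obtain ⟨N', hN'⟩ := exists_selfAdjoint_approx φ h (ε := min δ (ε / 2)) (by positivity)
    refine ⟨max N N', fun n hn => ?_⟩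
    obtain ⟨l', hl1, hl2⟩ := hN n (by omega)
    obtain ⟨b, hb1, hb2⟩ := hN' n (by omega)
    refine ⟨b :: l', ?_, ?_⟩
    · rw [StarAlgHom.map_prod_expUnitary] at hl1 ⊢
      simp only [List.map_cons, List.prod_cons]
      refine (unitary_norm_mul_sub_mul_le _ _ _ _).trans_lt ?_
      have h1 := hδ' ((toLim φ n).mapSelfAdjoint b) (by
        rw [Subtype.dist_eq, dist_eq_norm]
        exact hb1.trans_le (min_le_left _ _))
      rw [dist_eq_norm] at h1
      linarith
    · have := min_le_right δ (ε / 2)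
      simp only [List.map_cons, List.sum_cons]
      linarith

/-- A factorization of the image of a unitary into exponentials comes, up to an arbitrarily small
increase of the length, from a factorization at a finite stage. -/
theorem exists_prod_expUnitary_eq_trans {i : ℕ} (v : unitary (B i)) (l : List (selfAdjoint (Lim φ)))
    (hl : toLim φ i v = ((l.map selfAdjoint.expUnitary).prod : unitary (Lim φ))) {r : ℝ}
    (hr : (l.map fun h : selfAdjoint (Lim φ) => ‖(h : Lim φ)‖).sum < r) :
    ∃ n, ∃ hn : i ≤ n, ∃ l' : List (selfAdjoint (B n)),
      trans φ i hn v = ((l'.map selfAdjoint.expUnitary).prod : unitary (B n)) ∧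
      (l'.map fun h : selfAdjoint (B n) => ‖(h : B n)‖).sum < r := by
  set s := (l.map fun h : selfAdjoint (Lim φ) => ‖(h : Lim φ)‖).sum with hs
  -- The margin r - s is shared between the approximation of the exponents and one correcting
  -- factor. That δ is uniform over algebras matters, since the stage n is chosen after it.
  obtain ⟨δ, hδ, hδ'⟩ := exists_expUnitary_eq_of_near_one (ε := (r - s) / 2) (by linarith)
  obtain ⟨N, hN⟩ := exists_prod_expUnitary_approx φ l (ε := min δ ((r - s) / 2))
    (lt_min hδ (by linarith))
  obtain ⟨l₀, h1, h2⟩ := hN (max N i) (le_max_left _ _)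
  rw [← hl, ← toLim_trans φ (le_max_right N i), ← map_sub] at h1
  -- The norm in the limit is the limit of the norms along the stages, so closeness in the limit
  -- already holds at some stage.
  obtain ⟨n, hn, h3⟩ := exists_norm_trans_lt φ (h1.trans_le (min_le_left _ _))
  rw [map_sub, trans_trans, StarAlgHom.map_prod_expUnitary] at h3
  have hin : i ≤ n := (le_max_right N i).trans hn
  set l₁ := l₀.map (trans φ (max N i) hn).mapSelfAdjoint with hl₁
  let w : unitary (B n) := ⟨trans φ i hin v, Unitary.map_mem _ v.2⟩
  set p := (l₁.map selfAdjoint.expUnitary).prod with hp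
  have h4 : ‖((star p * w : unitary (B n)) : B n) - 1‖ < δ := by
    have e : ((star p * w : unitary (B n)) : B n) - 1 =
        ((star p : unitary (B n)) : B n) * (w - p) := by
      rw [mul_sub]; simp
    rw [e, CStarRing.norm_coe_unitary_mul, norm_sub_rev]
    exact h3
  obtain ⟨g, hg1, hg2⟩ := hδ' _ _ h4
  -- The remaining factor p* w is near 1, and its logarithm `g` makes the factorization exact.
  refine ⟨n, hin, l₁ ++ [g], ?_, ?_⟩
  · simp only [List.map_append, List.prod_append, List.map_cons, List.map_nil, List.prod_singleton,
      hg1, ← hp]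
    have : p * (star p * w) = w := by rw [← mul_assoc, Unitary.mul_star_self, one_mul]
    rw [this]
  · have h5 := (trans φ (max N i) hn).sum_norm_mapSelfAdjoint_le l₀
    have h6 := min_le_right δ ((r - s) / 2)
    simp only [List.map_append, List.sum_append, List.map_cons, List.map_nil, List.sum_singleton]
    linarith

end CStarIndLim

/-! ### The image of u at finite stages and the bound there -/

namespace AHExample

open Real

theorem size_pos (k : ℕ → ℕ) (n : ℕ) : 0 < size k n := by
  induction n with
  | zero => exact Nat.succ_pos _
  | succ n ih => exact Nat.mul_pos (by positivity) ih

/-- Evaluation at a point, as a `*`-homomorphism. -/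
noncomputable def evalHom (k : ℕ → ℕ) (n : ℕ) (t : unitInterval) :
    Stage k n →⋆ₐ[ℂ] Matrix (Fin (size k n)) (Fin (size k n)) ℂ where
  toFun f := f t
  map_one' := rfl
  map_mul' _ _ := rfl
  map_zero' := rfl
  map_add' _ _ := rfl
  commutes' _ := rfl
  map_star' _ := rfl

theorem blockDiag_diagonal {m L : ℕ} (e : Fin m → Fin L → ℂ) :
    blockDiag (fun j => Matrix.diagonal (e j)) =
      Matrix.diagonal fun i => e (finProdFinEquiv.symm i).1 (finProdFinEquiv.symm i).2 := by
  rw [blockDiag, Matrix.blockDiagonal_diagonal, Matrix.submatrix_diagonal]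
  · rfl
  · exact Prod.swap_injective.comp finProdFinEquiv.symm.injective

theorem conn_apply (x : ℕ → unitInterval) (k : ℕ → ℕ) (n : ℕ) (f : Stage k n) (t : unitInterval) :
    conn x k n f t = blockDiag fun j : Fin (10 ^ k n) =>
      if (j : ℕ) + 1 = 10 ^ k n then f (x n) else f t := rfl

theorem card_filter_succ_ne {m : ℕ} (hm : 0 < m) :
    (Finset.univ.filter fun j : Fin m => (j : ℕ) + 1 ≠ m).card = m - 1 := by
  have : (Finset.univ.filter fun j : Fin m => (j : ℕ) + 1 ≠ m) =
      Finset.univ.erase ⟨m - 1, by omega⟩ := by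
    ext j
    simp only [Finset.mem_filter, Finset.mem_univ, true_and, Finset.mem_erase, and_true, ne_eq,
      Fin.ext_iff]
    have := j.2
    omega
  rw [this, Finset.card_erase_of_mem (Finset.mem_univ _), Finset.card_univ, Fintype.card_fin]

/-- The image of `u` at stage `n` is a diagonal matrix with entries `e ^ (i α j t)`, where the
`α j` sum to zero. For the indices `j` in a set `G`, whose proportion is given by the partial
product, the entry moves from `1` to `e ^ (2 π i / 10)`; for the other indices it is the same at
both ends. -/
theorem exists_trans_u_eq_diagonal (x : ℕ → unitInterval) (k : ℕ → ℕ) (n : ℕ) :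
    ∃ (α : Fin (size k n) → unitInterval → ℝ) (G : Finset (Fin (size k n))),
      (∀ t, CStarIndLim.trans (conn x k) 0 (Nat.zero_le n) (u k : Stage k 0) t =
        Matrix.diagonal fun i => Complex.exp (α i t * Complex.I)) ∧
      (∀ t, ∑ i, α i t = 0) ∧
      (∀ i ∈ G, α i 0 = 0 ∧
        Complex.exp (α i 1 * Complex.I) = Complex.exp ((2 * π / 10 : ℝ) * Complex.I)) ∧
      (∀ i, i ∉ G → α i 1 = α i 0) ∧
      (G.card : ℝ) = size k n * ∏ j ∈ Finset.range n, ((10 : ℝ) ^ k j - 1) / (10 : ℝ) ^ k j := by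
  induction n with
  | zero =>
    refine ⟨fun i t => if (i : ℕ) = 0 then -(2 * π * t * (9 / 10)) else 2 * π * t * (1 / 10),
      Finset.univ, fun t => ?_, fun t => ?_, fun i _ => ⟨?_, ?_⟩, fun i hi => ?_, ?_⟩
    · rw [CStarIndLim.trans_self]
      refine congrArg Matrix.diagonal (funext fun i => ?_)
      unfold uEntry
      dsimp only
      split_ifs <;> rfl
    · change ∑ i : Fin 10, (if (i : ℕ) = 0 then _ else _) = _
      rw [Fin.sum_univ_succ]
      simp
      ring
    · simp
    · dsimp only
      split_ifs
      · rw [Complex.exp_eq_exp_iff_exists_int]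
        -- At t = 1 the first entry has angle -2π·9/10 = 2π/10 - 2π, so all ten entries end at the
        -- same point.
        exact ⟨-1, by push_cast; simp; ring⟩
      · simp; ring_nf
    · simp at hi
    · simp
  | succ n ih =>
    obtain ⟨α, G, h1, h2, h3, h4, h5⟩ := ih
    let e : Fin (size k (n + 1)) → Fin (10 ^ k n) × Fin (size k n) := finProdFinEquiv.symm
    have hm : 0 < 10 ^ k n := by positivity
    -- The last block is frozen at `x n`, so its entries are constant and leave G; in the other
    -- blocks each index inherits its status.
    refine ⟨fun i t => α (e i).2 (if ((e i).1 : ℕ) + 1 = 10 ^ k n then x n else t),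
      Finset.univ.filter fun i => ((e i).1 : ℕ) + 1 ≠ 10 ^ k n ∧ (e i).2 ∈ G,
      fun t => ?_, fun t => ?_, fun i hi => ?_, fun i hi => ?_, ?_⟩
    · rw [CStarIndLim.trans_succ _ _ (Nat.zero_le n), conn_apply]
      refine Eq.trans (congrArg blockDiag (funext fun j => ?_)) (blockDiag_diagonal
        fun j i => Complex.exp (α i (if (j : ℕ) + 1 = 10 ^ k n then x n else t) * Complex.I))
      split_ifs <;> rw [h1]
    · have : ∑ i : Fin (size k (n + 1)), α (e i).2 (if ((e i).1 : ℕ) + 1 = 10 ^ k n then x n else t) =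
          ∑ p : Fin (10 ^ k n) × Fin (size k n),
            α p.2 (if (p.1 : ℕ) + 1 = 10 ^ k n then x n else t) :=
        finProdFinEquiv.symm.sum_comp
          (fun p : Fin (10 ^ k n) × Fin (size k n) =>
            α p.2 (if (p.1 : ℕ) + 1 = 10 ^ k n then x n else t))
      rw [this, Fintype.sum_prod_type]
      exact Finset.sum_eq_zero fun j _ => h2 (if (j : ℕ) + 1 = 10 ^ k n then x n else t)
    · simp only [Finset.mem_filter, Finset.mem_univ, true_and] at hi
      simpa [hi.1] using h3 _ hi.2
    · simp only [Finset.mem_filter, Finset.mem_univ, true_and, not_and] at hi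
      by_cases hj : ((e i).1 : ℕ) + 1 = 10 ^ k n
      · simp [hj]
      · simpa [hj] using h4 _ (hi hj)
    · have hcard : (Finset.univ.filter fun i => ((e i).1 : ℕ) + 1 ≠ 10 ^ k n ∧ (e i).2 ∈ G).card =
          (10 ^ k n - 1) * G.card := by
        rw [← card_filter_succ_ne hm, ← Finset.card_product]
        refine Finset.card_equiv finProdFinEquiv.symm fun i => ?_
        simp only [e, Finset.mem_filter, Finset.mem_univ, true_and, Finset.mem_product]
        rfl
      rw [hcard, Finset.prod_range_succ]
      push_cast [Nat.cast_sub (Nat.one_le_iff_ne_zero.2 hm.ne'), size]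
      rw [h5]
      have : (10 : ℝ) ^ k n ≠ 0 := by positivity
      field_simp

/-- All factors lie in [0, 1], so every finite product over a set containing `Finset.range n` is at
most the n-th partial product. -/
theorem le_prod_range_of_hasProd {k : ℕ → ℕ} {P : ℝ}
    (hP : HasProd (fun n => ((10 : ℝ) ^ k n - 1) / (10 : ℝ) ^ k n) P) (n : ℕ) :
    P ≤ ∏ j ∈ Finset.range n, ((10 : ℝ) ^ k j - 1) / (10 : ℝ) ^ k j := by
  refine le_of_tendsto hP ?_
  filter_upwards [Filter.eventually_ge_atTop (Finset.range n)] with s hs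
  have h1 (i : ℕ) : (1 : ℝ) ≤ (10 : ℝ) ^ k i := one_le_pow₀ (by norm_num)
  refine Finset.prod_le_prod_of_subset_of_le_one hs (fun i _ => ?_) (fun i _ _ => ?_)
  · exact div_nonneg (by linarith [h1 i]) (by positivity)
  · exact (div_le_one (by positivity)).2 (by linarith)

theorem det_prod_expUnitary {n : Type*} [Fintype n] [DecidableEq n] (l : List (selfAdjoint (Matrix n n ℂ))) :
    (((l.map selfAdjoint.expUnitary).prod : unitary (Matrix n n ℂ)) : Matrix n n ℂ).det =
      Complex.exp ((l.map fun g : selfAdjoint (Matrix n n ℂ) => (g : Matrix n n ℂ).trace.re).sum * Complex.I) := by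
  induction l with
  | nil => simp
  | cons g l ih =>
    have hg : (g : Matrix n n ℂ).IsHermitian := g.2
    rw [List.map_cons, List.prod_cons, Submonoid.coe_mul, Matrix.det_mul, ih, List.map_cons, List.sum_cons,
      selfAdjoint.expUnitary_coe, hg.hasAngles_exp.det_eq, hg.sum_eigenvalues_eq, ← Complex.exp_add]
    push_cast
    rw [add_mul]

/-- A continuous function on a connected space with values in the discrete set 2πℤ is constant. -/
theorem eq_of_exp_mul_I_eq_one {f : unitInterval → ℝ} (hf : Continuous f)
    (h : ∀ t, Complex.exp (f t * Complex.I) = 1) (s t : unitInterval) : f s = f t := by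
  have hd : IsDiscrete (AddSubgroup.zmultiples (2 * π) : Set ℝ) :=
    ⟨inferInstanceAs (DiscreteTopology (AddSubgroup.zmultiples (2 * π)))⟩
  obtain ⟨y, -, hy⟩ := isPreconnected_univ.eqOn_const_of_mapsTo hd hf.continuousOn (fun t _ => by
    obtain ⟨m, hm⟩ := Complex.exp_eq_one_iff.1 (h t)
    refine AddSubgroup.mem_zmultiples_iff.2 ⟨m, ?_⟩
    have := congrArg Complex.im hm
    simpa using this.symm) ⟨0, zero_mem _⟩
  exact (hy (Set.mem_univ s)).trans (hy (Set.mem_univ t)).symm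

theorem continuous_sum_trace {k : ℕ → ℕ} {n : ℕ} (l : List (selfAdjoint (Stage k n))) :
    Continuous fun t : unitInterval =>
      (l.map fun g : selfAdjoint (Stage k n) => ((g : Stage k n) t).trace.re).sum := by
  induction l with
  | nil => exact continuous_const
  | cons g l ih =>
    simp only [List.map_cons, List.sum_cons]
    exact (Complex.continuous_re.comp (g : Stage k n).continuous.matrix_trace).add ih

/-- The two lifts of the same point of the circle to `[-r, 2π - r)` and `(s - 2π, s]` differ by at
most `2π` if `r + s < 4π`. -/
theorem neg_toIcoMod_sub_toIcoMod_le {r s a : ℝ} (h : r + s < 4 * π) :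
    -toIcoMod two_pi_pos (-s) (-a) - toIcoMod two_pi_pos (-r) a ≤ 2 * π := by
  have h1 := (toIcoMod_mem_Ico two_pi_pos (-s) (-a)).1
  have h2 := (toIcoMod_mem_Ico two_pi_pos (-r) a).1
  have h3 : -toIcoMod two_pi_pos (-s) (-a) - toIcoMod two_pi_pos (-r) a =
      (toIcoDiv two_pi_pos (-s) (-a) + toIcoDiv two_pi_pos (-r) a : ℤ) * (2 * π) := by
    simp only [toIcoMod, zsmul_eq_mul]
    push_cast
    ring
  set d := toIcoDiv two_pi_pos (-s) (-a) + toIcoDiv two_pi_pos (-r) a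
  have hd : d ≤ 1 := by
    by_contra! hc
    have : (2 : ℝ) ≤ d := by exact_mod_cast hc
    nlinarith [pi_pos]
  have : (d : ℝ) ≤ 1 := by exact_mod_cast hd
  rw [h3]
  nlinarith [pi_pos]

theorem toIcoMod_eq_of_exp_eq {a b r : ℝ} (h : Complex.exp (a * Complex.I) = Complex.exp (b * Complex.I))
    (hb : b ∈ Set.Ico r (r + 2 * π)) : toIcoMod two_pi_pos r a = b := by
  obtain ⟨m, hm⟩ := Complex.exp_eq_exp_iff_exists_int.1 h
  rw [toIcoMod_eq_iff]
  refine ⟨hb, m, ?_⟩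
  have := congrArg Complex.im hm
  simpa using this

/-- The core of the length bound: the total trace T is constant in t, while a short factorization
would force the lifts at t = 1 to outweigh those at t = 0. -/
theorem sum_norm_ge_of_trans_u_eq (x : ℕ → unitInterval) {k : ℕ → ℕ} {P : ℝ}
    (hP : HasProd (fun n => ((10 : ℝ) ^ k n - 1) / (10 : ℝ) ^ k n) P) (hP_lt : 11 / 12 < P) {n : ℕ}
    (l : List (selfAdjoint (Stage k n)))
    (hl : CStarIndLim.trans (conn x k) 0 (Nat.zero_le n) (u k : Stage k 0) =
      ((l.map selfAdjoint.expUnitary).prod : unitary (Stage k n))) :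
    2 * π * (9 / 10) ≤ (l.map fun g : selfAdjoint (Stage k n) => ‖(g : Stage k n)‖).sum := by
  by_contra! hlt
  obtain ⟨α, G, h1, h2, h3, h4, h5⟩ := exists_trans_u_eq_diagonal x k n
  let lt (t : unitInterval) := l.map (evalHom k n t).mapSelfAdjoint
  let T (t : unitInterval) : ℝ :=
    (l.map fun g : selfAdjoint (Stage k n) => ((g : Stage k n) t).trace.re).sum
  let r (t : unitInterval) : ℝ :=
    ((lt t).map fun g : selfAdjoint (Matrix (Fin (size k n)) (Fin (size k n)) ℂ) =>
      ‖(g : Matrix (Fin (size k n)) (Fin (size k n)) ℂ)‖).sum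
  have hr0 t : 0 ≤ r t := List.sum_nonneg fun y hy => by
    obtain ⟨g, -, rfl⟩ := List.mem_map.1 hy
    exact norm_nonneg _
  have hr t : r t < 2 * π * (9 / 10) := ((evalHom k n t).sum_norm_mapSelfAdjoint_le l).trans_lt hlt
  have hprod t : (((lt t).map selfAdjoint.expUnitary).prod : unitary _).1 =
      Matrix.diagonal fun i => Complex.exp (α i t * Complex.I) := by
    rw [← h1 t, hl]
    exact ((evalHom k n t).map_prod_expUnitary l).symm
  have hT t : ((lt t).map fun g : selfAdjoint (Matrix (Fin (size k n)) (Fin (size k n)) ℂ) =>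
      (g : Matrix (Fin (size k n)) (Fin (size k n)) ℂ).trace.re).sum = T t := by
    simp only [lt, List.map_map]
    rfl
  have hdet t : Complex.exp (T t * Complex.I) = 1 := by
    rw [← hT, ← det_prod_expUnitary, hprod, (Matrix.hasAngles_diagonal _).det_eq, h2]
    simp
  have hT01 : T 0 = T 1 := eq_of_exp_mul_I_eq_one (continuous_sum_trace l) hdet 0 1
  have hlow := Matrix.sum_toIcoMod_le_of_prod_exp ((lt 1).map Subtype.val) (fun g hg => by
      obtain ⟨g', -, rfl⟩ := List.mem_map.1 hg
      exact g'.2) (r := r 1) (by rw [List.map_map]; rfl) (fun i => α i 1) (by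
      rw [← coe_prod_expUnitary]; exact hprod 1)
  have hup := Matrix.sum_toIcoMod_neg_le_of_prod_exp ((lt 0).map Subtype.val) (fun g hg => by
      obtain ⟨g', -, rfl⟩ := List.mem_map.1 hg
      exact g'.2) (r := r 0) (by rw [List.map_map]; rfl) (fun i => α i 0) (by
      rw [← coe_prod_expUnitary]; exact hprod 0)
  rw [List.map_map] at hlow hup
  replace hlow := hlow.trans_eq (hT 1)
  replace hup := hup.trans_eq (congrArg Neg.neg (hT 0))
  have hpi := pi_pos
  -- Upper lift at t = 0 minus lower lift at t = 1. For an index in G this is 0 - 2π/10 = 2π -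
  -- 2π·11/10; 2π/10 < 2π - r(1) is where the bound 2π·9/10 enters.
  have hterm i : -toIcoMod two_pi_pos (-r 0) (-α i 0) - toIcoMod two_pi_pos (-r 1) (α i 1) ≤
      2 * π - if i ∈ G then 2 * π * (11 / 10) else 0 := by
    by_cases hi : i ∈ G
    · obtain ⟨g0, g1⟩ := h3 i hi
      rw [toIcoMod_eq_of_exp_eq g1 ⟨by linarith [hr0 1], by linarith [hr 1]⟩,
        toIcoMod_eq_of_exp_eq (b := 0) (by rw [g0, neg_zero])
          ⟨by linarith [hr0 0], by linarith [hr 0]⟩, if_pos hi]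
      linarith
    · rw [h4 i hi, if_neg hi, sub_zero]
      exact neg_toIcoMod_sub_toIcoMod_le (by linarith [hr 0, hr 1])
  have hsum := Finset.sum_le_sum fun i (_ : i ∈ Finset.univ) => hterm i
  simp only [Finset.sum_sub_distrib, Finset.sum_neg_distrib, Finset.sum_ite_mem, Finset.univ_inter,
    Finset.sum_const, Finset.card_univ, Fintype.card_fin, nsmul_eq_mul] at hsum
  have hcard : (size k n : ℝ) * (11 / 12) ≤ G.card := by
    rw [h5]
    exact mul_le_mul_of_nonneg_left (hP_lt.le.trans (le_prod_range_of_hasProd hP n)) (by positivity)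
  have hpos : (0 : ℝ) < size k n := by exact_mod_cast size_pos k n
  -- Since T(0) = T(1), the summed differences are at least 0.
  have : (G.card : ℝ) * (11 / 10) ≤ size k n := by
    have : 2 * π * ((G.card : ℝ) * (11 / 10)) ≤ 2 * π * size k n := by linarith
    exact le_of_mul_le_mul_left this two_pi_pos
  linarith

/-! ### Commutators, the identity component, and the AH property -/

open scoped commutatorElement

/-- The self-adjoint element `t ↦ diag (2 π t c j)` of the first stage. -/
noncomputable def diagSelfAdjoint (k : ℕ → ℕ) (c : Fin (size k 0) → ℝ) : selfAdjoint (Stage k 0) :=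
  ⟨{ toFun := fun t => Matrix.diagonal fun i => ((2 * π * t * c i : ℝ) : ℂ)
     continuous_toFun := Continuous.matrix_diagonal (by fun_prop) }, by
    ext1 t
    rw [ContinuousMap.star_apply, ContinuousMap.coe_mk, Matrix.star_eq_conjTranspose,
      Matrix.diagonal_conjTranspose]
    refine congrArg Matrix.diagonal (funext fun i => ?_)
    simp⟩

theorem expUnitary_diagSelfAdjoint_apply (k : ℕ → ℕ) (c : Fin (size k 0) → ℝ) (t : unitInterval) :
    (selfAdjoint.expUnitary (diagSelfAdjoint k c) : Stage k 0) t =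
      Matrix.diagonal fun i => Complex.exp ((2 * π * t * c i : ℝ) * Complex.I) := by
  refine ((evalHom k 0 t).map_expUnitary (diagSelfAdjoint k c)).trans ?_
  have : ((evalHom k 0 t).mapSelfAdjoint (diagSelfAdjoint k c) :
      Matrix (Fin (size k 0)) (Fin (size k 0)) ℂ) =
      Matrix.diagonal fun i => ((2 * π * t * c i : ℝ) : ℂ) := rfl
  rw [selfAdjoint.expUnitary_coe, this, ← Matrix.diagonal_smul, Matrix.exp_diagonal]
  refine congrArg Matrix.diagonal (funext fun i => ?_)
  rw [Pi.coe_exp, ← Complex.exp_eq_exp_ℂ, Pi.smul_apply, smul_eq_mul, mul_comm]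

theorem u_eq_expUnitary (k : ℕ → ℕ) : u k = selfAdjoint.expUnitary
    (diagSelfAdjoint k fun i => if (i : ℕ) = 0 then -(9 / 10) else 1 / 10) := by
  ext1
  ext1 t
  rw [expUnitary_diagSelfAdjoint_apply]
  refine congrArg Matrix.diagonal (funext fun i => ?_)
  unfold uEntry
  split_ifs
  · rw [mul_neg]
  · rfl

/-- The cyclic permutation matrix, as a constant unitary of the first stage. -/
noncomputable def cyclicShift (k : ℕ → ℕ) : unitary (Stage k 0) :=
  ⟨ContinuousMap.const _ ((finRotate (size k 0)).permMatrix ℂ), by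
    rw [Unitary.mem_iff]
    constructor <;> ext1 t <;>
    rw [ContinuousMap.mul_apply, ContinuousMap.star_apply, ContinuousMap.const_apply,
      Matrix.star_eq_conjTranspose, Matrix.conjTranspose_permMatrix, ← Matrix.permMatrix_mul] <;>
    simp⟩

/-- For D = diag(e^{2πit c_i}) and the cyclic shift S, the commutator D S D* S* has exponents c_i -
c_{i+1}, cyclically. The exponents of u sum to zero, so they are such differences: c = (0, 9/10,
8/10, …, 1/10). -/
theorem u_eq_commutatorElement (k : ℕ → ℕ) : u k = ⁅selfAdjoint.expUnitary
    (diagSelfAdjoint k fun i => if (i : ℕ) = 0 then 0 else (10 - (i : ℝ)) / 10), cyclicShift k⁆ := by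
  ext1
  ext1 t
  rw [u_eq_expUnitary, expUnitary_diagSelfAdjoint_apply, commutatorElement_def,
    mul_assoc (selfAdjoint.expUnitary _) (cyclicShift k), mul_assoc (selfAdjoint.expUnitary _),
    ← Unitary.star_eq_inv, ← Unitary.star_eq_inv]
  simp only [Submonoid.coe_mul, Unitary.coe_star, ContinuousMap.mul_apply, ContinuousMap.star_apply,
    expUnitary_diagSelfAdjoint_apply]
  have hs : (cyclicShift k : Stage k 0) t = (finRotate (size k 0)).permMatrix ℂ := rfl
  rw [hs, Matrix.star_eq_conjTranspose, Matrix.star_eq_conjTranspose, Matrix.conjTranspose_permMatrix,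
    Matrix.diagonal_conjTranspose, Equiv.Perm.permMatrix, Equiv.Perm.permMatrix,
    PEquiv.toMatrix_toPEquiv_mul, PEquiv.mul_toMatrix_toPEquiv, Matrix.submatrix_submatrix]
  have h2 : (finRotate (size k 0))⁻¹.symm = finRotate (size k 0) := rfl
  rw [h2, Function.comp_id, Function.id_comp, Matrix.submatrix_diagonal_equiv,
    Matrix.diagonal_mul_diagonal]
  refine congrArg Matrix.diagonal (funext fun i => ?_)
  rw [Function.comp_apply, Pi.star_apply, Complex.star_def, ← Complex.exp_conj, ← Complex.exp_add]
  congr 1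
  change Fin 10 at i
  simp only [map_mul, Complex.conj_ofReal, Complex.conj_I, mul_neg, ← sub_eq_add_neg, ← sub_mul,
    ← Complex.ofReal_sub, ← mul_sub]
  congr 4
  change _ = _ - (if (finRotate 10 i : ℕ) = 0 then 0 else (10 - ((finRotate 10 i : ℕ) : ℝ)) / 10)
  rw [finRotate_apply, Fin.val_add_one]
  -- The shift wraps around at i = 9, where the difference is 1/10 - 0.
  by_cases h9 : i = Fin.last 9
  · subst h9
    norm_num [Fin.val_last]
  · rw [if_neg h9, if_neg (Nat.succ_ne_zero _)]
    push_cast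
    split_ifs with h0
    · rw [h0]; norm_num
    · ring

theorem uLim_mem_CU (x : ℕ → unitInterval) (k : ℕ → ℕ) : uLim x k ∈ CU (LimAlg x k) := by
  refine Subgroup.le_topologicalClosure _ ?_
  have : uLim x k = Unitary.map (.ofClass (CStarIndLim.toLim (conn x k) 0)) (u k) := rfl
  rw [this, u_eq_commutatorElement, map_commutatorElement]
  exact Subgroup.commutator_mem_commutator (Subgroup.mem_top _) (Subgroup.mem_top _)

theorem uLim_eq_expUnitary (x : ℕ → unitInterval) (k : ℕ → ℕ) :
    ∃ h : selfAdjoint (LimAlg x k), uLim x k = selfAdjoint.expUnitary h := by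
  refine ⟨(CStarIndLim.toLim (conn x k) 0).mapSelfAdjoint
    (diagSelfAdjoint k fun i => if (i : ℕ) = 0 then -(9 / 10) else 1 / 10), Subtype.ext ?_⟩
  rw [← StarAlgHom.map_expUnitary, ← u_eq_expUnitary]
  rfl

theorem uLim_mem_connectedComponent (x : ℕ → unitInterval) (k : ℕ → ℕ) :
    uLim x k ∈ connectedComponent (1 : unitary (LimAlg x k)) := by
  obtain ⟨h, hh⟩ := uLim_eq_expUnitary x k
  rw [hh]
  exact pathComponent_subset_component _ (selfAdjoint.joined_one_expUnitary h)

theorem le_cel_uLim (x : ℕ → unitInterval) {k : ℕ → ℕ} {P : ℝ}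
    (hP : HasProd (fun n => ((10 : ℝ) ^ k n - 1) / (10 : ℝ) ^ k n) P) (hP_lt : 11 / 12 < P) :
    2 * π * (9 / 10) ≤ cel (uLim x k) := by
  refine le_csInf ?_ ?_
  -- A one-factor factorization exists, so the infimum is not the default value `sInf ∅ = 0`.
  · obtain ⟨h, hh⟩ := uLim_eq_expUnitary x k
    exact ⟨_, [h], by simpa using hh, rfl⟩
  · rintro _ ⟨l, hl, rfl⟩
    -- In `cel` the sum runs over the list of coerced elements; the terms are the same.
    have e : (l.map fun h : selfAdjoint (LimAlg x k) => ‖(h : LimAlg x k)‖) =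
        List.map (fun h => ‖h‖) (do let a ← l; pure (a : LimAlg x k)) := by
      simp
    rw [← e]
    by_contra! hlt
    obtain ⟨n, hn, l', h1, h2⟩ := CStarIndLim.exists_prod_expUnitary_eq_trans (conn x k) (u k) l
      (congrArg Subtype.val hl) hlt
    exact absurd (sum_norm_ge_of_trans_u_eq x hP hP_lt l' h1) (not_le.2 h2)

theorem isHomogeneousSum_stage (k : ℕ → ℕ) (n : ℕ) : IsHomogeneousSum (Stage k n) := by
  refine ⟨1, fun _ => unitInterval, inferInstance, inferInstance, inferInstance, fun _ => size k n, 1,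
    { toFun := fun f _ => f
      map_smul' := fun _ _ => rfl
      map_zero' := rfl
      map_add' := fun _ _ => rfl
      map_mul' := fun _ _ => rfl
      map_star' := fun _ => rfl }, IsStarProjection.one _, fun f g h => congrFun h 0, ?_⟩
  ext a
  refine ⟨fun ⟨f, hf⟩ => ⟨a, by simp⟩, fun ⟨b, hb⟩ => ⟨a 0, ?_⟩⟩
  funext j
  rw [Subsingleton.elim j 0]
  rfl

theorem isAH_limAlg (x : ℕ → unitInterval) (k : ℕ → ℕ) : IsAH (LimAlg x k) :=
  ⟨Stage k, inferInstance, conn x k, isHomogeneousSum_stage k, ⟨StarAlgEquiv.refl ℂ _⟩⟩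

end AHExample

/-! ### Simplicity -/

/-- A matrix of norm greater than `c` has a left multiple that is a nonzero idempotent, with a
multiplier of norm at most `1 / c`. -/
theorem Matrix.exists_mul_idempotent {n : Type*} [Fintype n] [DecidableEq n] (M : Matrix n n ℂ)
    {c : ℝ} (hc : 0 < c) (hM : c < ‖M‖) :
    ∃ N : Matrix n n ℂ, ‖N‖ ≤ 1 / c ∧ (N * M) * (N * M) = N * M ∧ N * M ≠ 0 := by
  set f := Matrix.toEuclideanCLM (n := n) (𝕜 := ℂ) M with hf
  rw [← Matrix.l2_opNorm_toEuclideanCLM] at hM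
  obtain ⟨v, hv, hw⟩ := f.exists_lt_apply_of_lt_opNorm hM
  set w := f v with hwdef
  have hw0 : 0 < ‖w‖ := hc.trans hw
  have hww : inner ℂ w w = (‖w‖ : ℂ) ^ 2 := inner_self_eq_norm_sq_to_K w
  -- The rank-one map ‖w‖⁻² v ⟨w, ·⟩ sends w = Mv back to v, so g ∘ M fixes v and has range in the
  -- line of v.
  let g : EuclideanSpace ℂ n →L[ℂ] EuclideanSpace ℂ n :=
    ((‖w‖ : ℂ) ^ 2)⁻¹ • (innerSL ℂ w).smulRight v
  have hg (y) : g y = (((‖w‖ : ℂ) ^ 2)⁻¹ * inner ℂ w y) • v := by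
    simp [g, smul_smul]
  have hgv : g (f v) = v := by
    rw [← hwdef, hg, hww, inv_mul_cancel₀ (by simpa using hw0.ne'), one_smul]
  have hv0 : v ≠ 0 := by
    rintro rfl
    simp [hwdef] at hw0
  have hgM : Matrix.toEuclideanCLM (n := n) (𝕜 := ℂ)
      ((Matrix.toEuclideanCLM (n := n) (𝕜 := ℂ)).symm g * M) = g * f := by
    rw [map_mul, StarAlgEquiv.apply_symm_apply]
  refine ⟨(Matrix.toEuclideanCLM (n := n) (𝕜 := ℂ)).symm g, ?_, ?_, ?_⟩
  · rw [← Matrix.l2_opNorm_toEuclideanCLM, StarAlgEquiv.apply_symm_apply, norm_smul,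
      ContinuousLinearMap.norm_smulRight_apply, innerSL_apply_norm, norm_inv, norm_pow,
      Complex.norm_real, norm_norm]
    calc (‖w‖ ^ 2)⁻¹ * (‖w‖ * ‖v‖) ≤ (‖w‖ ^ 2)⁻¹ * (‖w‖ * 1) := by gcongr
      _ = 1 / ‖w‖ := by field_simp
      _ ≤ 1 / c := by gcongr
  · apply EquivLike.injective (Matrix.toEuclideanCLM (n := n) (𝕜 := ℂ))
    rw [map_mul, hgM]
    ext1 y
    change g (f (g (f y))) = g (f y)
    rw [hg (f y), map_smul, map_smul, hgv]
  · intro h0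
    rw [h0, map_zero] at hgM
    have h1 : g (f v) = 0 := congrArg (fun q => q v) hgM.symm
    exact hv0 (hgv.symm.trans h1)

/-- If an ideal contains an element whose left multiple by `z` is close to an idempotent `e`, then
it contains `e`. -/
theorem TwoSidedIdeal.idempotent_mem_of_near {A : Type*} [NormedRing A] [CompleteSpace A]
    (I : TwoSidedIdeal A) {a z e : A} (ha : a ∈ I) (he : e * e = e)
    (h : ‖e‖ * ‖e - z * a‖ * ‖e‖ < 1) : e ∈ I := by
  set r := e * (e - z * a) * e with hr
  have hr1 : ‖r‖ < 1 := ((norm_mul_le _ _).trans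
    (mul_le_mul_of_nonneg_right (norm_mul_le _ _) (norm_nonneg _))).trans_lt h
  obtain ⟨v, hv⟩ := isUnit_one_sub_of_norm_lt_one hr1
  have her : e * r = r := by rw [hr, ← mul_assoc, ← mul_assoc, he]
  -- With r as above, e(1 - r) = e(za)e lies in the ideal, and 1 - r is invertible.
  have h1 : e * (v : A) = e * (z * a) * e := by
    rw [hv, mul_sub, mul_one, her, hr, mul_sub, sub_mul, he, he, sub_sub_cancel]
  have h2 : e * (v : A) ∈ I := by
    rw [h1]
    exact I.mul_mem_right _ _ (I.mul_mem_left _ _ (I.mul_mem_left _ _ ha))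
  have h3 := I.mul_mem_right _ (↑v⁻¹ : A) h2
  rwa [mul_assoc, Units.mul_inv, mul_one] at h3

namespace AHExample

theorem blockDiag_injective {m L : ℕ} :
    Function.Injective (blockDiag : (Fin m → Matrix (Fin L) (Fin L) ℂ) → _) := by
  intro c d h
  refine Matrix.blockDiagonal_injective (Matrix.ext fun p q => ?_)
  have := congrFun (congrFun h (finProdFinEquiv p.swap)) (finProdFinEquiv q.swap)
  simpa only [blockDiag, Matrix.submatrix_apply, Equiv.symm_apply_apply, Prod.swap_swap] using this

/-- An injective *-homomorphism of C*-algebras is isometric. -/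
theorem norm_blockDiag {m L : ℕ} (c : Fin m → Matrix (Fin L) (Fin L) ℂ) : ‖blockDiag c‖ = ‖c‖ := by
  let Φ : (Fin m → Matrix (Fin L) (Fin L) ℂ) →⋆ₙₐ[ℂ] Matrix (Fin (m * L)) (Fin (m * L)) ℂ :=
    { toFun := blockDiag
      map_smul' := fun z c => by
        simp only [blockDiag, Matrix.blockDiagonal_smul]; rfl
      map_zero' := by simp [blockDiag]
      map_add' := blockDiag_add
      map_mul' := blockDiag_mul
      map_star' := blockDiag_star }
  exact NonUnitalStarAlgHom.norm_map Φ blockDiag_injective c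

variable {x : ℕ → unitInterval} {k : ℕ → ℕ}

/-- If k n ≠ 0 there are at least two blocks, so the first one is f(t) itself and not the point
evaluation. -/
theorem norm_apply_le_norm_conn_apply {n : ℕ} (hk : k n ≠ 0) (f : Stage k n) (t : unitInterval) :
    ‖f t‖ ≤ ‖conn x k n f t‖ := by
  refine le_of_le_of_eq ?_ (norm_blockDiag _).symm
  have h1 : 1 < 10 ^ k n := Nat.one_lt_pow hk (by norm_num)
  have := norm_le_pi_norm (fun j : Fin (10 ^ k n) =>
    if (j : ℕ) + 1 = 10 ^ k n then f (x n) else f t) ⟨0, by omega⟩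
  simpa [h1.ne] using this

theorem norm_apply_le_norm_trans_apply (hk : ∀ n, k n ≠ 0) {i n : ℕ} (h : i ≤ n) (f : Stage k i)
    (t : unitInterval) : ‖f t‖ ≤ ‖CStarIndLim.trans (conn x k) i h f t‖ := by
  induction n, h using Nat.le_induction with
  | base => rw [CStarIndLim.trans_self]
  | succ n hn ih =>
    rw [CStarIndLim.trans_succ _ _ hn]
    exact ih.trans (norm_apply_le_norm_conn_apply (hk n) _ t)

/-- If k n = 0, the n-th factor is 0 and kills the product. -/
theorem ne_zero_of_hasProd {P : ℝ}
    (hP : HasProd (fun n => ((10 : ℝ) ^ k n - 1) / (10 : ℝ) ^ k n) P) (hP_pos : 0 < P) (n : ℕ) :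
    k n ≠ 0 := by
  intro h
  have := le_prod_range_of_hasProd hP (n + 1)
  rw [Finset.prod_range_succ, h] at this
  norm_num at this
  linarith

/-- The interval has no isolated points, so a dense set stays dense after finitely many points are
removed. -/
theorem exists_ge_mem_of_denseRange (hx : DenseRange x) {U : Set unitInterval} (hU : IsOpen U)
    (hne : U.Nonempty) (n : ℕ) : ∃ j, n ≤ j ∧ x j ∈ U := by
  have hd : Dense (Set.range x \ (x '' Set.Iio n)) := hx.sdiff_finite ((Set.finite_Iio n).image x)
  obtain ⟨y, hyU, ⟨j, rfl⟩, hj⟩ := hd.inter_open_nonempty U hU hne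
  refine ⟨j, ?_, hyU⟩
  by_contra! hlt
  exact hj ⟨j, hlt, rfl⟩

/-- Constant functions in a stage. -/
noncomputable def constHom (k : ℕ → ℕ) (n : ℕ) :
    Matrix (Fin (size k n)) (Fin (size k n)) ℂ →+* Stage k n where
  toFun := ContinuousMap.const _
  map_one' := rfl
  map_mul' _ _ := rfl
  map_zero' := rfl
  map_add' _ _ := rfl

instance (k : ℕ → ℕ) (n : ℕ) : Nonempty (Fin (size k n)) := ⟨⟨0, size_pos k n⟩⟩

theorem nontrivial_limAlg (x : ℕ → unitInterval) (k : ℕ → ℕ) : Nontrivial (LimAlg x k) := by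
  refine ⟨1, 0, fun h => ?_⟩
  have h1 : ‖CStarIndLim.toLim (conn x k) 0 1‖ < 1 := by rw [map_one, h]; simp
  obtain ⟨n, hn, h2⟩ := CStarIndLim.exists_norm_trans_lt (conn x k) h1
  rw [map_one, CStarRing.norm_one] at h2
  exact lt_irrefl _ h2

theorem isSimpleCStar_limAlg (hx : DenseRange x) (hk : ∀ n, k n ≠ 0) :
    IsSimpleCStar (LimAlg x k) := by
  refine ⟨nontrivial_limAlg x k, fun I _ => or_iff_not_imp_left.2 fun hI => ?_⟩
  obtain ⟨a₀, ha₀, hne⟩ : ∃ a ∈ I, a ≠ 0 := by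
    by_contra! h
    exact hI (le_antisymm (fun a ha => by simpa using h a ha) bot_le)
  obtain ⟨a, haI, ha1⟩ : ∃ a ∈ I, ‖a‖ = 1 := by
    refine ⟨((‖a₀‖⁻¹ : ℝ) : ℂ) • a₀, ?_, ?_⟩
    · rw [← smul_one_mul]
      exact I.mul_mem_left _ _ ha₀
    · rw [norm_smul, Complex.norm_real, norm_inv, norm_norm,
        inv_mul_cancel₀ (norm_ne_zero_iff.2 hne)]
  obtain ⟨n, hn⟩ := CStarIndLim.exists_approx (conn x k) a (ε := 1 / 8) (by norm_num)
  obtain ⟨b, hb1, hb2⟩ := hn n le_rfl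
  rw [ha1] at hb2
  have hb3 : 7 / 8 < ‖b‖ := by
    have h1 := NonUnitalStarAlgHom.norm_apply_le (CStarIndLim.toLim (conn x k) n) b
    have h2 := norm_le_norm_add_norm_sub' a (CStarIndLim.toLim (conn x k) n b)
    rw [norm_sub_rev] at h2
    linarith
  obtain ⟨t₀, ht₀⟩ : ∃ t, 7 / 8 < ‖b t‖ := by
    by_contra! h
    exact absurd ((ContinuousMap.norm_le b (by norm_num)).2 h) (not_le.2 hb3)
  -- The index j must be at least n, so that the evaluation at `x j` comes after the stage of b.
  obtain ⟨j, hnj, hj⟩ := exists_ge_mem_of_denseRange hx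
    (isOpen_lt continuous_const (continuous_norm.comp b.continuous)) ⟨t₀, ht₀⟩ n
  set g := CStarIndLim.trans (conn x k) n hnj b with hg
  have hgx : 7 / 8 < ‖g (x j)‖ := lt_of_lt_of_le hj (norm_apply_le_norm_trans_apply hk hnj b (x j))
  obtain ⟨N, hN1, hN2, hN3⟩ := Matrix.exists_mul_idempotent (g (x j)) (by norm_num) hgx
  let last (M : Matrix (Fin (size k j)) (Fin (size k j)) ℂ) :
      Matrix (Fin (size k (j + 1))) (Fin (size k (j + 1))) ℂ :=
    blockDiag fun i : Fin (10 ^ k j) => if (i : ℕ) + 1 = 10 ^ k j then M else 0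
  have hlast_mul (M M') : last M * last M' = last (M * M') := by
    refine Eq.trans (blockDiag_mul _ _).symm (congrArg blockDiag (funext fun i => ?_))
    split_ifs <;> simp
  set e := last (N * g (x j)) with he
  have hee : e * e = e := by rw [he, hlast_mul, hN2]
  have he0 : e ≠ 0 := by
    intro h0
    have h1 : (fun i : Fin (10 ^ k j) => if (i : ℕ) + 1 = 10 ^ k j then N * g (x j) else 0) = 0 :=
      blockDiag_injective (h0.trans (by simp [blockDiag]; rfl))
    have hpos : 0 < 10 ^ k j := by positivity
    have h2 := congrFun h1 ⟨10 ^ k j - 1, by omega⟩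
    rw [if_pos (Nat.sub_add_cancel hpos)] at h2
    exact hN3 h2
  -- The last block of the image of g is the constant g(x_j), and multiplying by `last N` erases all
  -- other blocks; the result is a constant idempotent.
  have hZ : constHom k (j + 1) (last N) * conn x k j g = constHom k (j + 1) e := by
    ext1 t
    refine Eq.trans (blockDiag_mul _ _).symm (congrArg blockDiag (funext fun i => ?_))
    split_ifs <;> simp
  have hZn : ‖constHom k (j + 1) (last N)‖ ≤ 8 / 7 := by
    refine (ContinuousMap.norm_le _ (by norm_num)).2 fun t => ?_
    refine (norm_blockDiag _).trans_le ((pi_norm_le_iff_of_nonneg (by norm_num)).2 fun i => ?_)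
    split_ifs
    · exact hN1.trans (by norm_num)
    · rw [norm_zero]; norm_num
  set τ := CStarIndLim.toLim (conn x k) (j + 1)
  have hτ : τ (conn x k j g) = CStarIndLim.toLim (conn x k) n b := by
    rw [hg, ← CStarIndLim.trans_succ, CStarIndLim.toLim_trans]
  have hEeq : τ (constHom k (j + 1) e) =
      τ (constHom k (j + 1) (last N)) * CStarIndLim.toLim (conn x k) n b := by
    rw [← hZ, map_mul, hτ]
  have hτZ : ‖τ (constHom k (j + 1) (last N))‖ ≤ 8 / 7 :=
    (NonUnitalStarAlgHom.norm_apply_le τ _).trans hZn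
  have hb4 : ‖CStarIndLim.toLim (conn x k) n b‖ ≤ 9 / 8 :=
    (NonUnitalStarAlgHom.norm_apply_le _ b).trans (by linarith)
  have hEn : ‖τ (constHom k (j + 1) e)‖ ≤ 9 / 7 := by
    rw [hEeq]
    refine (norm_mul_le _ _).trans
      ((mul_le_mul hτZ hb4 (norm_nonneg _) (by norm_num)).trans (by norm_num))
  have hEd : ‖τ (constHom k (j + 1) e) - τ (constHom k (j + 1) (last N)) * a‖ ≤ 1 / 7 := by
    rw [hEeq, ← mul_sub]
    refine (norm_mul_le _ _).trans
      ((mul_le_mul hτZ hb1.le (norm_nonneg _) (by norm_num)).trans (by norm_num))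
  have hE : τ (constHom k (j + 1) e) ∈ I := by
    refine I.idempotent_mem_of_near haI (z := τ (constHom k (j + 1) (last N)))
      (by rw [← map_mul, ← map_mul, hee]) ?_
    calc _ ≤ (9 / 7 : ℝ) * (1 / 7) * (9 / 7) := by gcongr
      _ < 1 := by norm_num
  -- The constant matrices at stage j + 1 form a simple ring, embedded unitally; their ideal J
  -- contains e ≠ 0, hence 1.
  let J := I.comap ((τ : Stage k (j + 1) →+* LimAlg x k).comp (constHom k (j + 1)))
  have hJ : J = ⊤ := by
    refine (eq_bot_or_eq_top J).resolve_left fun hbot => he0 ?_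
    have : e ∈ J := (TwoSidedIdeal.mem_comap _).2 hE
    rw [hbot] at this
    simpa using this
  have h1 : (1 : Matrix (Fin (size k (j + 1))) (Fin (size k (j + 1))) ℂ) ∈ J := by rw [hJ]; trivial
  have h2 := (TwoSidedIdeal.mem_comap _).1 h1
  rw [map_one] at h2
  exact (TwoSidedIdeal.one_mem_iff I).1 h2

end AHExample

theorem corollary3p15 (x : ℕ → unitInterval) (hx_inj : Function.Injective x)
    (hx_dense : DenseRange x) (k : ℕ → ℕ) (P : ℝ)
    (hP : HasProd (fun n => ((10 : ℝ) ^ k n - 1) / (10 : ℝ) ^ k n) P) (hP_lt : 11 / 12 < P) :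
    IsSimpleCStar (AHExample.LimAlg x k) ∧
    IsAH (AHExample.LimAlg x k) ∧
    AHExample.uLim x k ∈ CU (AHExample.LimAlg x k) ∧
    AHExample.uLim x k ∈ connectedComponent (1 : unitary (AHExample.LimAlg x k)) ∧
    2 * Real.pi * (9 / 10) ≤ cel (AHExample.uLim x k) := by
  exact ⟨AHExample.isSimpleCStar_limAlg hx_dense
      (AHExample.ne_zero_of_hasProd hP (by linarith)),
    AHExample.isAH_limAlg x k, AHExample.uLim_mem_CU x k, AHExample.uLim_mem_connectedComponent x k,
    AHExample.le_cel_uLim x hP hP_lt⟩
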